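/- Let $K$ be a perfect field with algebraic closure $\overline K$, and let $X\subset\mathbb P^4_K$ be a $9$-nodal cubic threefold over $K$. By this we mean that $X$ is a cubic hypersurface such that $X_{\overline K}$ has exactly $9$ singular points and every $\mathrm{Gal}(\overline K/K)$-orbit of singular points has at least $4$ members. Then: (i) Every singular point of $X_{\overline K}$ is an ordinary node, that is, its local equation in four affine coordinates has a nondegenerate quadratic term. (ii) $X_{\overline K}$ contains exactly nine $2$-planes, and they form a single orbit under $\mathrm{Gal}(\overline K/K)$. (iii) Let $G$ be the graph whose vertices are the $2$-planes in $X_{\overline K}$, two vertices being joined if the corresponding planes meet in a line. Then $G$ is isomorphic to the $1$-skeleton of the cell decomposition of a $2$-torus obtained as the product of two triangles (that is, to the Cartesian product of two $3$-cycles). (iv) The group of the configuration of nodes and planes, that is, the group of all pairs consisting of a permutation of the nodes and a permutation of the planes that together preserve incidence, is isomorphic to $\Gamma=S_3\wr S_2$, the subgroup of $S_6$ generated by $S_3\times S_3$ and the involution that switches the two factors. The group $\mathrm{Gal}(\overline K/K)$ acts on the configuration through a homomorphism to this group. -/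

import Mathlib

namespace CubicThreefold

open MvPolynomial
open scoped LinearAlgebra.Projectivization

/-- The geometric projective space `ℙ⁴` over the field `k`. -/
abbrev P4 (k : Type*) [Field k] : Type _ := ℙ k (Fin 5 → k)

/-- The singular points of the hypersurface `F = 0` in `ℙ⁴` (Jacobian criterion): `F` and all its
first partial derivatives vanish. For homogeneous `F` the representative is irrelevant. -/
def singularPoints {k : Type*} [Field k] (F : MvPolynomial (Fin 5) k) : Set (P4 k) :=
  {p | eval p.rep F = 0 ∧ ∀ i, eval p.rep (pderiv i F) = 0}

/-- The matrix of second partial derivatives of `F` at the vector `v`. -/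
noncomputable def hessian {k : Type*} [Field k] (F : MvPolynomial (Fin 5) k) (v : Fin 5 → k) :
    Matrix (Fin 5) (Fin 5) k :=
  Matrix.of fun i j => eval v (pderiv i (pderiv j F))

/-- `p = [v]` is an ordinary node of `F = 0`: it is a singular point, and the quadratic term
of the local equation `F (v + w) = 0` is nondegenerate. That term is a quadratic form in
`w ∈ k⁵ / k v` (four variables) whose polar bilinear form is the Hessian of `F` at `v`; it is
nondegenerate iff the radical of the Hessian form on `k⁵` is just the line `k v`.
Since the number of local variables is even, this is the usual notion in characteristic `2` as
well: the projectivised tangent cone is a smooth quadric surface. -/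
def IsOrdinaryNode {k : Type*} [Field k] (F : MvPolynomial (Fin 5) k) (p : P4 k) : Prop :=
  p ∈ singularPoints F ∧
    ∀ w : Fin 5 → k, (hessian F p.rep).mulVec w = 0 → w ∈ p.submodule

/-- The `2`-planes of `ℙ⁴` (three-dimensional linear subspaces of `k⁵`) contained in the
hypersurface `F = 0`; to be used over an algebraically closed field `k`. -/
def planes {k : Type*} [Field k] (F : MvPolynomial (Fin 5) k) :
    Set (Submodule k (Fin 5 → k)) :=
  {W | Module.finrank k W = 3 ∧ ∀ v ∈ W, eval v F = 0}

/-- The graph whose vertices are the `2`-planes in `F = 0`, two of them being joined if they meet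
in a line of `ℙ⁴`. -/
def planeGraph {k : Type*} [Field k] (F : MvPolynomial (Fin 5) k) : SimpleGraph (planes F) where
  Adj W W' := Module.finrank k ((W : Submodule k (Fin 5 → k)) ⊓ W' : Submodule k (Fin 5 → k)) = 2
  symm := ⟨fun W W' h => by rwa [inf_comm]⟩
  loopless := ⟨fun W h => by
    have h3 := W.2.1
    rw [inf_idem] at h
    omega⟩

/-- The symmetry group of the configuration of singular points and `2`-planes of `F = 0`: pairs
consisting of a permutation of the singular points and a permutation of the planes which
together preserve the incidence relation "the point lies on the plane". -/
def configurationGroup {k : Type*} [Field k] (F : MvPolynomial (Fin 5) k) :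
    Subgroup (Equiv.Perm (singularPoints F) × Equiv.Perm (planes F)) where
  carrier := {g | ∀ p W, ((g.1 p : P4 k).submodule ≤ (g.2 W : Submodule k (Fin 5 → k)) ↔
    (p : P4 k).submodule ≤ (W : Submodule k (Fin 5 → k)))}
  one_mem' := fun _ _ => Iff.rfl
  mul_mem' := fun {a b} ha hb p W => (ha (b.1 p) (b.2 W)).trans (hb p W)
  inv_mem' := fun {a} ha p W => by
    have h := ha (a.1⁻¹ p) (a.2⁻¹ W)
    simp only [Equiv.Perm.inv_def, Equiv.apply_symm_apply] at h
    exact h.symm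

/-- The wreath product `S₃ ≀ S₂`, as the subgroup of `S₆` generated by `S₃ × S₃` and the
involution which switches the two triples. -/
def Gam : Subgroup (Equiv.Perm (Fin 3 ⊕ Fin 3)) :=
  Subgroup.closure
    (Set.range (Equiv.Perm.sumCongrHom (Fin 3) (Fin 3)) ∪ {Equiv.sumComm (Fin 3) (Fin 3)})

/-- The 1-skeleton of the 2-torus `S¹ × S¹` with the product of the cell decompositions of the two
circles as triangles: its edges are the products of an edge of one triangle
and a vertex of the other. -/
def torusSkeleton : SimpleGraph (Fin 3 × Fin 3) :=
  SimpleGraph.boxProd (SimpleGraph.cycleGraph 3) (SimpleGraph.cycleGraph 3)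

/-- A Galois automorphism acting on vectors coordinate by coordinate; it is semilinear. -/
def galMap {K L : Type*} [Field K] [Field L] [Algebra K L] (σ : L ≃ₐ[K] L) :
    (Fin 5 → L) →ₛₗ[(σ.toRingEquiv : L →+* L)] (Fin 5 → L) where
  toFun v := fun i => σ (v i)
  map_add' v w := by ext i; simp
  map_smul' c v := by ext i; simp

theorem galMap_injective {K L : Type*} [Field K] [Field L] [Algebra K L] (σ : L ≃ₐ[K] L) :
    Function.Injective (galMap σ) := fun v w h => by
  ext i
  exact σ.injective (congrFun h i)

/-- The action of Galois automorphisms on geometric points. -/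
def galPoint {K L : Type*} [Field K] [Field L] [Algebra K L] (σ : L ≃ₐ[K] L) : P4 L → P4 L :=
  Projectivization.map (galMap σ) (galMap_injective σ)

/-- The action of Galois automorphisms on linear subspaces. -/
def galSubspace {K L : Type*} [Field K] [Field L] [Algebra K L] (σ : L ≃ₐ[K] L)
    (W : Submodule L (Fin 5 → L)) : Submodule L (Fin 5 → L) :=
  W.map (galMap σ)

/-- The base change of a form over `K` to the extension `L`. -/
noncomputable def geom {K : Type*} (L : Type*) [Field K] [Field L] [Algebra K L]
    (F : MvPolynomial (Fin 5) K) : MvPolynomial (Fin 5) L :=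
  F.map (algebraMap K L)

/-- `F = 0` is a 9-nodal cubic threefold over `K`, where `L` is an algebraic closure of `K`:
a cubic hypersurface in `ℙ⁴` with exactly nine singular geometric points, each
Galois orbit of which has at least four members. -/
structure IsNineNodalCubic {K : Type*} (L : Type*) [Field K] [Field L] [Algebra K L]
    (F : MvPolynomial (Fin 5) K) : Prop where
  cubic : F.IsHomogeneous 3
  nine : (singularPoints (geom L F)).ncard = 9
  orbits : ∀ p ∈ singularPoints (geom L F),
    4 ≤ (Set.range fun σ : L ≃ₐ[K] L => galPoint σ p).ncard

end CubicThreefold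

/-! The cubic is replaced by a trilinear form `M`, and the theorem is reduced to one explicit model:
a hyperplane section of the Perazzo cubic, `α l₀ l₁ l₂ = β m₀ m₁ m₂` with `∑ lᵢ = ∑ mⱼ`, where the
six linear forms have no common zero.

Reaching the model. With respect to independent singular vectors the cubic is squarefree, with
coefficients `pol M (e i) (e j) (e l)`. Finiteness of the singular locus then restricts the
coordinates of any further singular point: two or four nonzero coordinates are impossible
(`no_collinear`, `no_solid`), and for three or five the point is determined by its support. The last
claim comes from the Cremona map `x ↦ 1/x`, which makes the equations linear, up to one quadric
whose polar equations they are; two solutions would give a pencil of them. Four independent vectors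
allow at most 4 + 4 = 8 supports, so nine singular points span, and at least four supports of size 3
or 5 occur besides the five basis vectors. Two of these are triples sharing two indices. Normalizing
those two leaves five unknown coefficients, and the remaining two supports impose enough relations
for the cubic to become visibly a difference of two products of linear forms (`exists_normalForm`).

Using the model. The nine points where only `lᵢ` and `mⱼ` are nonzero are singular, hence they are
all the singular points, and their nondegeneracy is a direct computation. The planes `lᵢ = mⱼ = 0`
lie in the cubic. Any other plane would force `α = β`, which would create a tenth singular point.
Nodes and planes are thus both labelled by a 3 × 3 grid, a node lying on a plane exactly when both
row and column differ, and two planes meeting in a line exactly when they are distinct and share a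
row or column. This gives the torus graph, and the automorphism group of the grid, of order 72, is
the wreath product.

Galois action. An orbit size divides 72, so it is not 5; nine nodes in orbits of size at least 4
therefore form one orbit, and 9 divides the order of the image of Galois. The stabilizer of a plane
in the whole group has order 8, so every orbit of planes has size divisible by 9
(`orbit_eq_univ_of_four_le`). -/

namespace CubicThreefold

open scoped LinearAlgebra.Projectivization

/-! ### Singular points of cubics, with finiteness of the singular locus as the source of
contradictions -/

section CubicMap

variable {k V : Type*} [Field k] [AddCommGroup V] [Module k V]

/-- The cubic map `v ↦ M v v v` of a trilinear form. -/
def cub (M : V →ₗ[k] V →ₗ[k] V →ₗ[k] k) (v : V) : k := M v v v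

/-- The derivative of `cub M` at `v` in the direction `w`. -/
def dif (M : V →ₗ[k] V →ₗ[k] V →ₗ[k] k) (v w : V) : k := M w v v + M v w v + M v v w

/-- The full polarization of `cub M`. -/
def pol (M : V →ₗ[k] V →ₗ[k] V →ₗ[k] k) (u v w : V) : k :=
  M u v w + M u w v + M v u w + M v w u + M w u v + M w v u

/-- `v` is a singular vector of `cub M`. -/
def IsSing (M : V →ₗ[k] V →ₗ[k] V →ₗ[k] k) (v : V) : Prop := cub M v = 0 ∧ ∀ w, dif M v w = 0

variable (M : V →ₗ[k] V →ₗ[k] V →ₗ[k] k)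

theorem cub_add (u v : V) : cub M (u + v) = cub M u + dif M u v + dif M v u + cub M v := by
  simp only [cub, dif, map_add, LinearMap.add_apply]; ring

theorem cub_smul (c : k) (v : V) : cub M (c • v) = c ^ 3 * cub M v := by
  simp only [cub, map_smul, LinearMap.smul_apply, smul_eq_mul]; ring

theorem dif_add (u v w : V) : dif M (u + v) w = dif M u w + dif M v w + pol M u v w := by
  simp only [pol, dif, map_add, LinearMap.add_apply]; ring

theorem dif_smul (c : k) (v w : V) : dif M (c • v) w = c ^ 2 * dif M v w := by
  simp only [dif, map_smul, LinearMap.smul_apply, smul_eq_mul]; ring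

theorem dif_add_right (u v w : V) : dif M u (v + w) = dif M u v + dif M u w := by
  simp only [dif, map_add, LinearMap.add_apply]; ring

theorem dif_smul_right (c : k) (v w : V) : dif M v (c • w) = c * dif M v w := by
  simp only [dif, map_smul, LinearMap.smul_apply, smul_eq_mul]; ring

theorem pol_add_left (u u' v w : V) : pol M (u + u') v w = pol M u v w + pol M u' v w := by
  simp only [pol, map_add, LinearMap.add_apply]; ring

theorem pol_smul_left (c : k) (u v w : V) : pol M (c • u) v w = c * pol M u v w := by
  simp only [pol, map_smul, LinearMap.smul_apply, smul_eq_mul]; ring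

theorem pol_add_mid (u v v' w : V) : pol M u (v + v') w = pol M u v w + pol M u v' w := by
  simp only [pol, map_add, LinearMap.add_apply]; ring

theorem pol_smul_mid (c : k) (u v w : V) : pol M u (c • v) w = c * pol M u v w := by
  simp only [pol, map_smul, LinearMap.smul_apply, smul_eq_mul]; ring

theorem pol_add_right (u v w w' : V) : pol M u v (w + w') = pol M u v w + pol M u v w' := by
  simp only [pol, map_add, LinearMap.add_apply]; ring

theorem pol_smul_right (c : k) (u v w : V) : pol M u v (c • w) = c * pol M u v w := by
  simp only [pol, map_smul, LinearMap.smul_apply, smul_eq_mul]; ring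

theorem pol_swap_left (u v w : V) : pol M u v w = pol M v u w := by simp only [pol]; ring

theorem pol_swap_right (u v w : V) : pol M u v w = pol M u w v := by simp only [pol]; ring

theorem pol_self_right (u w : V) : pol M u w w = 2 * dif M w u := by simp only [pol, dif]; ring

variable {M}

theorem IsSing.smul {v : V} (h : IsSing M v) (c : k) : IsSing M (c • v) :=
  ⟨by rw [cub_smul, h.1, mul_zero], fun w => by rw [dif_smul, h.2, mul_zero]⟩

theorem isSing_smul_iff {v : V} {c : k} (hc : c ≠ 0) : IsSing M (c • v) ↔ IsSing M v :=
  ⟨fun h => by simpa [smul_smul, hc] using h.smul c⁻¹, fun h => h.smul c⟩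

variable (M) in
/-- The singular points of the cubic hypersurface `cub M = 0`. -/
def singPts : Set (ℙ k V) := {p | IsSing M p.rep}

theorem mk_mem_singPts {v : V} (hv : v ≠ 0) :
    Projectivization.mk k v hv ∈ singPts M ↔ IsSing M v := by
  obtain ⟨a, ha⟩ := Projectivization.exists_smul_eq_mk_rep k v hv
  change IsSing M _ ↔ _
  rw [← ha]
  exact isSing_smul_iff a.ne_zero

/-- The form in which isolatedness of the singularities is used: a family of pairwise
non-proportional singular vectors, with finitely many parameters excluded, is impossible over an
infinite field. -/
theorem false_of_family [Infinite k] (hM : (singPts M).Finite) (f : k → V) (Z : Set k)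
    (hZ : Z.Finite) (h0 : ∀ t ∉ Z, f t ≠ 0) (hs : ∀ t ∉ Z, IsSing M (f t))
    (hinj : ∀ s ∉ Z, ∀ t ∉ Z, ∀ c : k, f s = c • f t → s = t) : False := by
  have : Infinite ↥(Zᶜ) := hZ.infinite_compl.to_subtype
  have := hM.to_subtype
  refine not_injective_infinite_finite
    (fun t : ↥(Zᶜ) => (⟨Projectivization.mk k (f t) (h0 t t.2),
      (mk_mem_singPts _).2 (hs t t.2)⟩ : singPts M)) ?_
  intro s t hst
  have h := Subtype.ext_iff.1 hst
  rw [Projectivization.mk_eq_mk_iff'] at h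
  obtain ⟨c, hc⟩ := h
  exact Subtype.ext (hinj s s.2 t t.2 c hc.symm)

theorem coords_unique {n : ℕ} {e : Fin n → V} (he : LinearIndependent k e) {x y : Fin n → k}
    (h : ∑ i, x i • e i = ∑ i, y i • e i) : x = y :=
  funext fun i => by
    have := Fintype.linearIndependent_iffₛ.1 he x y h i
    exact this

theorem coords_ne_zero {n : ℕ} {e : Fin n → V} (he : LinearIndependent k e) {x : Fin n → k}
    (i : Fin n) (h : x i ≠ 0) : ∑ i, x i • e i ≠ 0 := fun h0 =>
  h (Fintype.linearIndependent_iff.1 he x h0 i)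

/-- In this and the following expansions the coefficients of `xᵢ³` and `xᵢ² xⱼ` are values of `cub`
and `dif` at singular vectors, hence zero. Only squarefree terms survive, in every characteristic.
-/
theorem dif_comb2 {e : Fin 2 → V} (hs : ∀ i, IsSing M (e i)) (x : Fin 2 → k) (w : V) :
    dif M (∑ i, x i • e i) w = x 0 * x 1 * pol M (e 0) (e 1) w := by
  simp only [Fin.sum_univ_two, dif_add, dif_smul, (hs _).2, pol_smul_left, pol_smul_mid]
  ring

theorem cub_comb2 {e : Fin 2 → V} (hs : ∀ i, IsSing M (e i)) (x : Fin 2 → k) :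
    cub M (∑ i, x i • e i) = 0 := by
  simp only [Fin.sum_univ_two, cub_add, dif_smul, dif_smul_right, cub_smul, (hs _).2, (hs _).1]
  ring

theorem dif_comb3 {e : Fin 3 → V} (hs : ∀ i, IsSing M (e i)) (x : Fin 3 → k) (w : V) :
    dif M (∑ i, x i • e i) w = x 0 * x 1 * pol M (e 0) (e 1) w + x 0 * x 2 * pol M (e 0) (e 2) w +
      x 1 * x 2 * pol M (e 1) (e 2) w := by
  simp only [Fin.sum_univ_three, dif_add, dif_smul, (hs _).2, pol_smul_left, pol_smul_mid,
    pol_add_left]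
  ring

theorem cub_comb3 {e : Fin 3 → V} (hs : ∀ i, IsSing M (e i)) (x : Fin 3 → k) :
    cub M (∑ i, x i • e i) = x 0 * x 1 * x 2 * pol M (e 0) (e 1) (e 2) := by
  simp only [Fin.sum_univ_three, cub_add, dif_smul, dif_smul_right, dif_add, dif_add_right,
    cub_smul, (hs _).2, (hs _).1, pol_smul_left, pol_smul_mid]
  ring

theorem dif_comb4 {e : Fin 4 → V} (hs : ∀ i, IsSing M (e i)) (x : Fin 4 → k) (w : V) :
    dif M (∑ i, x i • e i) w = x 0 * x 1 * pol M (e 0) (e 1) w + x 0 * x 2 * pol M (e 0) (e 2) w +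
      x 1 * x 2 * pol M (e 1) (e 2) w + x 0 * x 3 * pol M (e 0) (e 3) w +
      x 1 * x 3 * pol M (e 1) (e 3) w + x 2 * x 3 * pol M (e 2) (e 3) w := by
  simp only [Fin.sum_univ_four, dif_add, dif_smul, (hs _).2, pol_smul_left, pol_smul_mid,
    pol_add_left]
  ring

theorem cub_comb4 {e : Fin 4 → V} (hs : ∀ i, IsSing M (e i)) (x : Fin 4 → k) :
    cub M (∑ i, x i • e i) = x 0 * x 1 * x 2 * pol M (e 0) (e 1) (e 2) +
      x 0 * x 1 * x 3 * pol M (e 0) (e 1) (e 3) + x 0 * x 2 * x 3 * pol M (e 0) (e 2) (e 3) +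
      x 1 * x 2 * x 3 * pol M (e 1) (e 2) (e 3) := by
  simp only [Fin.sum_univ_four, cub_add, dif_smul, dif_smul_right, dif_add, dif_add_right,
    cub_smul, (hs _).2, (hs _).1, pol_smul_left, pol_smul_mid, pol_add_left]
  ring

theorem dif_comb5 {e : Fin 5 → V} (hs : ∀ i, IsSing M (e i)) (x : Fin 5 → k) (w : V) :
    dif M (∑ i, x i • e i) w = x 0 * x 1 * pol M (e 0) (e 1) w + x 0 * x 2 * pol M (e 0) (e 2) w +
      x 1 * x 2 * pol M (e 1) (e 2) w + x 0 * x 3 * pol M (e 0) (e 3) w +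
      x 1 * x 3 * pol M (e 1) (e 3) w + x 2 * x 3 * pol M (e 2) (e 3) w +
      x 0 * x 4 * pol M (e 0) (e 4) w + x 1 * x 4 * pol M (e 1) (e 4) w +
      x 2 * x 4 * pol M (e 2) (e 4) w + x 3 * x 4 * pol M (e 3) (e 4) w := by
  simp only [Fin.sum_univ_five, dif_add, dif_smul, (hs _).2, pol_smul_left, pol_smul_mid,
    pol_add_left]
  ring

theorem cub_comb5 {e : Fin 5 → V} (hs : ∀ i, IsSing M (e i)) (x : Fin 5 → k) :
    cub M (∑ i, x i • e i) = x 0 * x 1 * x 2 * pol M (e 0) (e 1) (e 2) +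
      x 0 * x 1 * x 3 * pol M (e 0) (e 1) (e 3) + x 0 * x 2 * x 3 * pol M (e 0) (e 2) (e 3) +
      x 1 * x 2 * x 3 * pol M (e 1) (e 2) (e 3) + x 0 * x 1 * x 4 * pol M (e 0) (e 1) (e 4) +
      x 0 * x 2 * x 4 * pol M (e 0) (e 2) (e 4) + x 1 * x 2 * x 4 * pol M (e 1) (e 2) (e 4) +
      x 0 * x 3 * x 4 * pol M (e 0) (e 3) (e 4) + x 1 * x 3 * x 4 * pol M (e 1) (e 3) (e 4) +
      x 2 * x 3 * x 4 * pol M (e 2) (e 3) (e 4) := by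
  simp only [Fin.sum_univ_five, cub_add, dif_smul, dif_smul_right, dif_add, dif_add_right,
    cub_smul, (hs _).2, (hs _).1, pol_smul_left, pol_smul_mid, pol_add_left]
  ring

/-- No three singular points of a cubic with isolated singularities are collinear. -/
theorem no_collinear [Infinite k] (hM : (singPts M).Finite) {e : Fin 2 → V}
    (he : LinearIndependent k e) (hs : ∀ i, IsSing M (e i)) {x : Fin 2 → k} (hx : ∀ i, x i ≠ 0)
    (h : IsSing M (∑ i, x i • e i)) : False := by
  -- A third singular point makes the mixed term vanish in every direction, so the whole line `e 0 +
  -- t • e 1` is singular.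
  have hT : ∀ w, pol M (e 0) (e 1) w = 0 := fun w => by
    have := h.2 w
    rw [dif_comb2 hs] at this
    simpa [hx] using this
  refine false_of_family hM (fun t => ∑ i, ![1, t] i • e i) ∅ Set.finite_empty
    (fun t _ => coords_ne_zero he 0 (by simp)) (fun t _ => ⟨cub_comb2 hs _, fun w => ?_⟩) ?_
  · rw [dif_comb2 hs, hT, mul_zero]
  · intro s _ t _ c hc
    simp only [Finset.smul_sum, smul_smul] at hc
    have h1 := coords_unique he (x := ![1, s]) (y := fun i => c * ![1, t] i) hc
    have h0 := congrFun h1 0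
    have h1 := congrFun h1 1
    simp at h0 h1
    rw [h1, ← h0, one_mul]

/-- The pencil of points whose inverted coordinates are `1 / x + t / y` is not singular. -/
theorem false_of_inverted_pencil [Infinite k] (hM : (singPts M).Finite) {n : ℕ} [NeZero n]
    {e : Fin n → V} (he : LinearIndependent k e) {x y : Fin n → k}
    (hx : ∀ i, x i ≠ 0) (hy : ∀ i, y i ≠ 0) (hne : ¬ ∃ c : k, y = c • x)
    (h : ∀ t, (∀ i, (x i)⁻¹ + t * (y i)⁻¹ ≠ 0) →
      IsSing M (∑ i, ((x i)⁻¹ + t * (y i)⁻¹)⁻¹ • e i)) : False := by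
  have hZ : (⋃ i, {t | (x i)⁻¹ + t * (y i)⁻¹ = 0}).Finite := Set.finite_iUnion fun i => by
    refine Set.Subsingleton.finite fun s hs t ht => ?_
    simp only [Set.mem_ofPred_eq] at hs ht
    exact mul_right_cancel₀ (inv_ne_zero (hy i)) (by linear_combination hs - ht)
  have hZY : ∀ t ∉ ⋃ i, {t | (x i)⁻¹ + t * (y i)⁻¹ = 0}, ∀ i, (x i)⁻¹ + t * (y i)⁻¹ ≠ 0 :=
    fun t ht i h => ht (Set.mem_iUnion.2 ⟨i, h⟩)
  refine false_of_family hM _ _ hZ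
    (fun t ht => coords_ne_zero he 0 (inv_ne_zero (hZY t ht 0))) (fun t ht => h t (hZY t ht)) ?_
  intro s hs t ht c hc
  simp only [Finset.smul_sum, smul_smul] at hc
  have h1 := fun i => congrFun (coords_unique he hc) i
  -- Proportionality of the members `s` and `t`, with denominators cleared. If `c = 1` it gives `s =
  -- t`; otherwise it makes `y` a multiple of `x`.
  have h2 : ∀ i, (1 - c) * y i = (c * s - t) * x i := fun i => by
    have a := hZY s hs i
    have b := hZY t ht i
    have h2 : (x i)⁻¹ + t * (y i)⁻¹ = c * ((x i)⁻¹ + s * (y i)⁻¹) := by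
      have := h1 i
      rw [inv_eq_iff_eq_inv, mul_inv, inv_inv, eq_comm, ← div_eq_inv_mul] at this
      by_cases hc0 : c = 0
      · rw [hc0] at this
        simp at this
        exact absurd this.symm a
      · rw [div_eq_iff hc0] at this
        rw [this, mul_comm]
    have := hx i; have := hy i
    field_simp at h2
    linear_combination h2
  by_cases hc1 : c = 1
  · subst hc1
    have := h2 0
    simp only [sub_self, zero_mul, one_mul] at this
    exact sub_eq_zero.1 ((mul_eq_zero.1 this.symm).resolve_right (hx 0))
  · refine absurd ⟨(c * s - t) / (1 - c), funext fun i => ?_⟩ hne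
    have : 1 - c ≠ 0 := sub_ne_zero.2 (Ne.symm hc1)
    simp only [Pi.smul_apply, smul_eq_mul]
    field_simp
    linear_combination h2 i

/-- The plane spanned by three singular points contains at most one further singular point. -/
theorem coplanar_unique [Infinite k] (hM : (singPts M).Finite) {e : Fin 3 → V}
    (he : LinearIndependent k e) (hs : ∀ i, IsSing M (e i)) {x y : Fin 3 → k}
    (hx : ∀ i, x i ≠ 0) (hy : ∀ i, y i ≠ 0)
    (h : IsSing M (∑ i, x i • e i)) (h' : IsSing M (∑ i, y i • e i)) :
    ∃ c : k, y = c • x := by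
  by_contra hne
  have hP : pol M (e 0) (e 1) (e 2) = 0 := by
    have := h.1
    rw [cub_comb3 hs] at this
    simpa [hx] using this
  -- Dividing the derivative by `z 0 * z 1 * z 2` makes the condition linear in the inverses, so it
  -- passes to the pencil `1 / x + t / y`.
  have hline : ∀ z : Fin 3 → k, (∀ i, z i ≠ 0) → IsSing M (∑ i, z i • e i) → ∀ w,
      (z 2)⁻¹ * pol M (e 0) (e 1) w + (z 1)⁻¹ * pol M (e 0) (e 2) w +
        (z 0)⁻¹ * pol M (e 1) (e 2) w = 0 := by
    intro z hz hzs w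
    have h1 := hzs.2 w
    rw [dif_comb3 hs] at h1
    have := hz 0; have := hz 1; have := hz 2
    field_simp
    linear_combination h1
  refine false_of_inverted_pencil hM he hx hy hne fun t ht => ⟨?_, fun w => ?_⟩
  · rw [cub_comb3 hs, hP, mul_zero]
  · rw [dif_comb3 hs]
    have h1 := hline x hx h w
    have h2 := hline y hy h' w
    have t0 := ht 0
    have t1 := ht 1
    have t2 := ht 2
    have h3 : ((x 2)⁻¹ + t * (y 2)⁻¹) * pol M (e 0) (e 1) w +
      ((x 1)⁻¹ + t * (y 1)⁻¹) * pol M (e 0) (e 2) w +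
        ((x 0)⁻¹ + t * (y 0)⁻¹) * pol M (e 1) (e 2) w = 0 := by
      linear_combination h1 + t * h2
    generalize (x 0)⁻¹ + t * (y 0)⁻¹ = Y0 at *
    generalize (x 1)⁻¹ + t * (y 1)⁻¹ = Y1 at *
    generalize (x 2)⁻¹ + t * (y 2)⁻¹ = Y2 at *
    field_simp
    linear_combination h3

/-- A cubic with isolated singularities does not contain a hyperplane spanned by four singular
points. -/
theorem false_of_solid [Infinite k] (hM : (singPts M).Finite) (hV : Module.finrank k V = 5)
    {e : Fin 4 → V} (he : LinearIndependent k e) (hs : ∀ i, IsSing M (e i))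
    (t3 : pol M (e 0) (e 1) (e 2) = 0) (t2 : pol M (e 0) (e 1) (e 3) = 0)
    (t1 : pol M (e 0) (e 2) (e 3) = 0) (t0 : pol M (e 1) (e 2) (e 3) = 0) : False := by
  have hFD : FiniteDimensional k V := FiniteDimensional.of_finrank_eq_succ hV
  obtain ⟨e4, he4⟩ : ∃ v, v ∉ Submodule.span k (Set.range e) := by
    by_contra! hcon
    have h1 : Submodule.span k (Set.range e) = ⊤ := Submodule.eq_top_iff'.2 hcon
    have h2 := finrank_span_eq_card he
    rw [h1, finrank_top, hV] at h2
    simp at h2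
  have hb : LinearIndependent k (Fin.snoc e e4 : Fin 5 → V) :=
    linearIndependent_finSnoc.2 ⟨he, he4⟩
  have hw : ∀ w, ∃ (z : Fin 4 → k) (c : k), w = ∑ i, z i • e i + c • e4 := fun w => by
    let b := basisOfLinearIndependentOfCardEqFinrank hb (by simp [hV])
    refine ⟨fun i => b.repr w i.castSucc, b.repr w (Fin.last 4), ?_⟩
    have := b.sum_repr w
    rw [Fin.sum_univ_castSucc] at this
    have hl : (Fin.snoc e e4 : Fin 5 → V) 4 = e4 := Fin.snoc_last (α := fun _ => V) e4 e
    simpa [b, hl] using this.symm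
  have hself : ∀ i w, pol M w (e i) (e i) = 0 := fun i w => by
    rw [pol_self_right, (hs i).2, mul_zero]
  have hself' : ∀ i w, pol M (e i) w (e i) = 0 := fun i w => by
    rw [pol_swap_left, hself]
  have s1 := pol_swap_right M (e 0) (e 2) (e 1)
  have s6 : pol M (e 1) (e 2) (e 0) = pol M (e 0) (e 1) (e 2) := by
    rw [pol_swap_right, pol_swap_left]
  -- The cubic vanishes on the solid, so derivatives along it vanish too. Only the direction `e4`
  -- remains, and in the plane `x 3 = 0` it cuts out a conic of singular points.
  have key : ∀ a b c : k, a * b * pol M (e 0) (e 1) e4 + a * c * pol M (e 0) (e 2) e4 +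
      b * c * pol M (e 1) (e 2) e4 = 0 → IsSing M (∑ i, ![a, b, c, 0] i • e i) := by
    intro a b c habc
    refine ⟨by rw [cub_comb4 hs, t0, t1, t2, t3]; ring, fun w => ?_⟩
    obtain ⟨z, d, rfl⟩ := hw w
    rw [dif_comb4 hs]
    simp only [Fin.sum_univ_four, pol_add_right, pol_smul_right, hself, hself', s1, s6, t0, t1, t2,
      t3, Matrix.cons_val_zero, Matrix.cons_val_one, Matrix.cons_val]
    linear_combination d * habc
  by_cases hq : pol M (e 0) (e 2) e4 = 0 ∧ pol M (e 1) (e 2) e4 = 0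
  · refine false_of_family hM (fun t => ∑ i, ![1, 0, t, 0] i • e i) ∅ Set.finite_empty
      (fun t _ => coords_ne_zero he 0 (by simp)) (fun t _ => key _ _ _ ?_) ?_
    · rw [hq.1, hq.2]; ring
    · intro s _ t _ c hc
      simp only [Finset.smul_sum, smul_smul] at hc
      have h1 := fun i => congrFun (coords_unique he hc) i
      have h0 := h1 0
      have h2 := h1 2
      simp at h0 h2
      rw [h2, ← h0, one_mul]
  -- The conic passes through `e 2`, so it is parametrized by the lines through that point: put `b =
  -- t * a` and solve the remaining linear equation for `c`. In the degenerate case above it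
  -- contains the line joining `e 0` and `e 2`.
  · have hZ : {t | pol M (e 0) (e 2) e4 + pol M (e 1) (e 2) e4 * t = 0}.Finite := by
      refine Set.Subsingleton.finite fun s hs t ht => ?_
      simp only [Set.mem_ofPred_eq] at hs ht
      have h1 : pol M (e 1) (e 2) e4 ≠ 0 := fun h0 => hq ⟨by simpa [h0] using hs, h0⟩
      exact mul_left_cancel₀ h1 (by linear_combination hs - ht)
    refine false_of_family hM (fun t => ∑ i, ![pol M (e 0) (e 2) e4 + pol M (e 1) (e 2) e4 * t,
      t * (pol M (e 0) (e 2) e4 + pol M (e 1) (e 2) e4 * t), - pol M (e 0) (e 1) e4 * t, 0] i • e i)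
      _ hZ (fun t ht => coords_ne_zero he 0 (by simpa using ht)) (fun t _ => key _ _ _ ?_) ?_
    · ring
    · intro s hs t ht c hc
      simp only [Finset.smul_sum, smul_smul] at hc
      have h1 := fun i => congrFun (coords_unique he hc) i
      have h0 := h1 0
      have h2 := h1 1
      simp at h0 h2 hs ht
      refine mul_left_cancel₀ hs ?_
      linear_combination h2 - t * h0

/-- A hyperplane spanned by four singular points contains no singular point outside the four
coordinate planes. -/
theorem no_solid [Infinite k] (hM : (singPts M).Finite) (hV : Module.finrank k V = 5)
    {e : Fin 4 → V} (he : LinearIndependent k e) (hs : ∀ i, IsSing M (e i)) {x : Fin 4 → k}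
    (hx : ∀ i, x i ≠ 0) (h : IsSing M (∑ i, x i • e i)) : False := by
  have c0 := h.1
  have d1 := h.2 (e 1)
  have d2 := h.2 (e 2)
  have d3 := h.2 (e 3)
  rw [cub_comb4 hs] at c0
  rw [dif_comb4 hs] at d1 d2 d3
  have hself : ∀ i w, pol M w (e i) (e i) = 0 := fun i w => by
    rw [pol_self_right, (hs i).2, mul_zero]
  have hself' : ∀ i w, pol M (e i) w (e i) = 0 := fun i w => by
    rw [pol_swap_left, hself]
  have s1 := pol_swap_right M (e 0) (e 2) (e 1)
  have s2 := pol_swap_right M (e 0) (e 3) (e 2)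
  have s3 := pol_swap_right M (e 1) (e 3) (e 2)
  have s4 := pol_swap_right M (e 0) (e 3) (e 1)
  have s5 : pol M (e 2) (e 3) (e 1) = pol M (e 1) (e 2) (e 3) := by
    rw [pol_swap_right, pol_swap_left]
  simp only [hself, hself'] at d1 d2 d3
  -- Subtracting `x i` times the `i`-th derivative from the cubic removes every monomial containing
  -- `x i`. Only one squarefree monomial in four variables is left, so its coefficient is zero.
  have t3 : pol M (e 0) (e 1) (e 2) = 0 := by
    refine (mul_eq_zero.1 (?_ : (x 0 * x 1 * x 2) * _ = 0)).resolve_left (by simp [hx])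
    linear_combination c0 - x 3 * d3
  have t2 : pol M (e 0) (e 1) (e 3) = 0 := by
    refine (mul_eq_zero.1 (?_ : (x 0 * x 1 * x 3) * _ = 0)).resolve_left (by simp [hx])
    linear_combination c0 - x 2 * d2 + x 2 * x 0 * x 3 * s2 + x 1 * x 2 * x 3 * s3
  have t1 : pol M (e 0) (e 2) (e 3) = 0 := by
    refine (mul_eq_zero.1 (?_ : (x 0 * x 2 * x 3) * _ = 0)).resolve_left (by simp [hx])
    linear_combination c0 - x 1 * d1 + x 1 * x 2 * x 3 * s5 + x 0 * x 1 * x 3 * s4 +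
      x 0 * x 1 * x 2 * s1
  have t0 : pol M (e 1) (e 2) (e 3) = 0 := by
    simpa [hx, t1, t2, t3] using c0
  exact false_of_solid hM hV he hs t3 t2 t1 t0

/-- Singular points in coordinates with respect to five independent singular points. -/
theorem isSing_comb5_iff (hV : Module.finrank k V = 5)
    {e : Fin 5 → V} (he : LinearIndependent k e) (hs : ∀ i, IsSing M (e i)) (x : Fin 5 → k) :
    IsSing M (∑ i, x i • e i) ↔
      (x 0 * x 1 * x 2 * pol M (e 0) (e 1) (e 2) + x 0 * x 1 * x 3 * pol M (e 0) (e 1) (e 3) +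
        x 0 * x 1 * x 4 * pol M (e 0) (e 1) (e 4) + x 0 * x 2 * x 3 * pol M (e 0) (e 2) (e 3) +
        x 0 * x 2 * x 4 * pol M (e 0) (e 2) (e 4) + x 0 * x 3 * x 4 * pol M (e 0) (e 3) (e 4) +
        x 1 * x 2 * x 3 * pol M (e 1) (e 2) (e 3) + x 1 * x 2 * x 4 * pol M (e 1) (e 2) (e 4) +
        x 1 * x 3 * x 4 * pol M (e 1) (e 3) (e 4) + x 2 * x 3 * x 4 * pol M (e 2) (e 3) (e 4) = 0) ∧
      (x 1 * x 2 * pol M (e 0) (e 1) (e 2) + x 1 * x 3 * pol M (e 0) (e 1) (e 3) +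
        x 1 * x 4 * pol M (e 0) (e 1) (e 4) + x 2 * x 3 * pol M (e 0) (e 2) (e 3) +
        x 2 * x 4 * pol M (e 0) (e 2) (e 4) + x 3 * x 4 * pol M (e 0) (e 3) (e 4) = 0) ∧
      (x 0 * x 2 * pol M (e 0) (e 1) (e 2) + x 0 * x 3 * pol M (e 0) (e 1) (e 3) +
        x 0 * x 4 * pol M (e 0) (e 1) (e 4) + x 2 * x 3 * pol M (e 1) (e 2) (e 3) +
        x 2 * x 4 * pol M (e 1) (e 2) (e 4) + x 3 * x 4 * pol M (e 1) (e 3) (e 4) = 0) ∧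
      (x 0 * x 1 * pol M (e 0) (e 1) (e 2) + x 0 * x 3 * pol M (e 0) (e 2) (e 3) +
        x 0 * x 4 * pol M (e 0) (e 2) (e 4) + x 1 * x 3 * pol M (e 1) (e 2) (e 3) +
        x 1 * x 4 * pol M (e 1) (e 2) (e 4) + x 3 * x 4 * pol M (e 2) (e 3) (e 4) = 0) ∧
      (x 0 * x 1 * pol M (e 0) (e 1) (e 3) + x 0 * x 2 * pol M (e 0) (e 2) (e 3) +
        x 0 * x 4 * pol M (e 0) (e 3) (e 4) + x 1 * x 2 * pol M (e 1) (e 2) (e 3) +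
        x 1 * x 4 * pol M (e 1) (e 3) (e 4) + x 2 * x 4 * pol M (e 2) (e 3) (e 4) = 0) ∧
      (x 0 * x 1 * pol M (e 0) (e 1) (e 4) + x 0 * x 2 * pol M (e 0) (e 2) (e 4) +
        x 0 * x 3 * pol M (e 0) (e 3) (e 4) + x 1 * x 2 * pol M (e 1) (e 2) (e 4) +
        x 1 * x 3 * pol M (e 1) (e 3) (e 4) + x 2 * x 3 * pol M (e 2) (e 3) (e 4) = 0) := by
  have hself : ∀ i w, pol M w (e i) (e i) = 0 := fun i w => by
    rw [pol_self_right, (hs i).2, mul_zero]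
  have hself' : ∀ i w, pol M (e i) w (e i) = 0 := fun i w => by
    rw [pol_swap_left, hself]
  have hw : ∀ w, ∃ z : Fin 5 → k, w = ∑ i, z i • e i := fun w => by
    let b := basisOfLinearIndependentOfCardEqFinrank he (by simp [hV])
    refine ⟨fun i => b.repr w i, ?_⟩
    simpa [b] using (b.sum_repr w).symm
  have s021 : pol M (e 0) (e 2) (e 1) = pol M (e 0) (e 1) (e 2) := pol_swap_right _ _ _ _
  have s120 : pol M (e 1) (e 2) (e 0) = pol M (e 0) (e 1) (e 2) := by
    rw [pol_swap_right, pol_swap_left]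
  have s031 : pol M (e 0) (e 3) (e 1) = pol M (e 0) (e 1) (e 3) := pol_swap_right _ _ _ _
  have s130 : pol M (e 1) (e 3) (e 0) = pol M (e 0) (e 1) (e 3) := by
    rw [pol_swap_right, pol_swap_left]
  have s041 : pol M (e 0) (e 4) (e 1) = pol M (e 0) (e 1) (e 4) := pol_swap_right _ _ _ _
  have s140 : pol M (e 1) (e 4) (e 0) = pol M (e 0) (e 1) (e 4) := by
    rw [pol_swap_right, pol_swap_left]
  have s032 : pol M (e 0) (e 3) (e 2) = pol M (e 0) (e 2) (e 3) := pol_swap_right _ _ _ _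
  have s230 : pol M (e 2) (e 3) (e 0) = pol M (e 0) (e 2) (e 3) := by
    rw [pol_swap_right, pol_swap_left]
  have s042 : pol M (e 0) (e 4) (e 2) = pol M (e 0) (e 2) (e 4) := pol_swap_right _ _ _ _
  have s240 : pol M (e 2) (e 4) (e 0) = pol M (e 0) (e 2) (e 4) := by
    rw [pol_swap_right, pol_swap_left]
  have s043 : pol M (e 0) (e 4) (e 3) = pol M (e 0) (e 3) (e 4) := pol_swap_right _ _ _ _
  have s340 : pol M (e 3) (e 4) (e 0) = pol M (e 0) (e 3) (e 4) := by
    rw [pol_swap_right, pol_swap_left]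
  have s132 : pol M (e 1) (e 3) (e 2) = pol M (e 1) (e 2) (e 3) := pol_swap_right _ _ _ _
  have s231 : pol M (e 2) (e 3) (e 1) = pol M (e 1) (e 2) (e 3) := by
    rw [pol_swap_right, pol_swap_left]
  have s142 : pol M (e 1) (e 4) (e 2) = pol M (e 1) (e 2) (e 4) := pol_swap_right _ _ _ _
  have s241 : pol M (e 2) (e 4) (e 1) = pol M (e 1) (e 2) (e 4) := by
    rw [pol_swap_right, pol_swap_left]
  have s143 : pol M (e 1) (e 4) (e 3) = pol M (e 1) (e 3) (e 4) := pol_swap_right _ _ _ _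
  have s341 : pol M (e 3) (e 4) (e 1) = pol M (e 1) (e 3) (e 4) := by
    rw [pol_swap_right, pol_swap_left]
  have s243 : pol M (e 2) (e 4) (e 3) = pol M (e 2) (e 3) (e 4) := pol_swap_right _ _ _ _
  have s342 : pol M (e 3) (e 4) (e 2) = pol M (e 2) (e 3) (e 4) := by
    rw [pol_swap_right, pol_swap_left]
  constructor
  · intro h
    have c := h.1
    have d := fun i => h.2 (e i)
    simp only [dif_comb5 hs] at d
    rw [cub_comb5 hs] at c
    have d0 := d 0
    have d1 := d 1
    have d2 := d 2
    have d3 := d 3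
    have d4 := d 4
    simp only [hself, hself', s021, s120, s031, s130, s041, s140, s032, s230, s042, s240, s043,
      s340, s132, s231, s142, s241, s143, s341, s243, s342] at d0 d1 d2 d3 d4
    refine ⟨?_, ?_, ?_, ?_, ?_, ?_⟩
    · linear_combination c
    · linear_combination d0
    · linear_combination d1
    · linear_combination d2
    · linear_combination d3
    · linear_combination d4
  · rintro ⟨c, d0, d1, d2, d3, d4⟩
    refine ⟨by rw [cub_comb5 hs]; linear_combination c, fun w => ?_⟩
    obtain ⟨z, rfl⟩ := hw w
    rw [dif_comb5 hs]
    simp only [Fin.sum_univ_five, pol_add_right, pol_smul_right]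
    simp only [hself, hself', s021, s120, s031, s130, s041, s140, s032, s230, s042, s240, s043,
      s340, s132, s231, s142, s241, s143, s341, s243, s342]
    linear_combination z 0 * d0 + z 1 * d1 + z 2 * d2 + z 3 * d3 + z 4 * d4

/-- The Cremona transformation `y ↦ 1 / y` turns the equations of singular points into those of
the vertices of a quadric. -/
theorem isSing_inv_iff (hV : Module.finrank k V = 5)
    {e : Fin 5 → V} (he : LinearIndependent k e) (hs : ∀ i, IsSing M (e i)) {y : Fin 5 → k}
    (hy : ∀ i, y i ≠ 0) :
    IsSing M (∑ i, (y i)⁻¹ • e i) ↔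
      (y 3 * y 4 * pol M (e 0) (e 1) (e 2) + y 2 * y 4 * pol M (e 0) (e 1) (e 3) +
        y 2 * y 3 * pol M (e 0) (e 1) (e 4) + y 1 * y 4 * pol M (e 0) (e 2) (e 3) +
        y 1 * y 3 * pol M (e 0) (e 2) (e 4) + y 1 * y 2 * pol M (e 0) (e 3) (e 4) +
        y 0 * y 4 * pol M (e 1) (e 2) (e 3) + y 0 * y 3 * pol M (e 1) (e 2) (e 4) +
        y 0 * y 2 * pol M (e 1) (e 3) (e 4) + y 0 * y 1 * pol M (e 2) (e 3) (e 4) = 0) ∧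
      (y 4 * pol M (e 1) (e 2) (e 3) + y 3 * pol M (e 1) (e 2) (e 4) +
        y 2 * pol M (e 1) (e 3) (e 4) + y 1 * pol M (e 2) (e 3) (e 4) = 0) ∧
      (y 4 * pol M (e 0) (e 2) (e 3) + y 3 * pol M (e 0) (e 2) (e 4) +
        y 2 * pol M (e 0) (e 3) (e 4) + y 0 * pol M (e 2) (e 3) (e 4) = 0) ∧
      (y 4 * pol M (e 0) (e 1) (e 3) + y 3 * pol M (e 0) (e 1) (e 4) +
        y 1 * pol M (e 0) (e 3) (e 4) + y 0 * pol M (e 1) (e 3) (e 4) = 0) ∧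
      (y 4 * pol M (e 0) (e 1) (e 2) + y 2 * pol M (e 0) (e 1) (e 4) +
        y 1 * pol M (e 0) (e 2) (e 4) + y 0 * pol M (e 1) (e 2) (e 4) = 0) ∧
      (y 3 * pol M (e 0) (e 1) (e 2) + y 2 * pol M (e 0) (e 1) (e 3) +
        y 1 * pol M (e 0) (e 2) (e 3) + y 0 * pol M (e 1) (e 2) (e 3) = 0) := by
  rw [isSing_comb5_iff hV he hs]
  have y0 := hy 0
  have y1 := hy 1
  have y2 := hy 2
  have y3 := hy 3
  have y4 := hy 4
  field_simp
  generalize y 0 = z0 at *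
  generalize y 1 = z1 at *
  generalize y 2 = z2 at *
  generalize y 3 = z3 at *
  generalize y 4 = z4 at *
  -- With denominators cleared, the cubic becomes a quadric `Q(y)` and the `i`-th derivative becomes
  -- `Q - y i * ∂ᵢQ`. Hence the system is equivalent to `Q = 0` and all `∂ᵢQ = 0`; `Q = 0` is kept
  -- because Euler's relation does not yield it in characteristic 2.
  constructor
  · rintro ⟨c, d0, d1, d2, d3, d4⟩
    refine ⟨?_, ?_, ?_, ?_, ?_, ?_⟩
    · linear_combination c
    · refine mul_left_cancel₀ y0 ?_
      linear_combination c - d0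
    · refine mul_left_cancel₀ y1 ?_
      linear_combination c - d1
    · refine mul_left_cancel₀ y2 ?_
      linear_combination c - d2
    · refine mul_left_cancel₀ y3 ?_
      linear_combination c - d3
    · refine mul_left_cancel₀ y4 ?_
      linear_combination c - d4
  · rintro ⟨c, d0, d1, d2, d3, d4⟩
    refine ⟨?_, ?_, ?_, ?_, ?_, ?_⟩
    · linear_combination c
    · linear_combination c - z0 * d0
    · linear_combination c - z1 * d1
    · linear_combination c - z2 * d2
    · linear_combination c - z3 * d3
    · linear_combination c - z4 * d4

/-- At most one further singular point lies outside the coordinate hyperplanes determined by five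
independent singular points. -/
theorem generic_unique [Infinite k] (hM : (singPts M).Finite) (hV : Module.finrank k V = 5)
    {e : Fin 5 → V} (he : LinearIndependent k e) (hs : ∀ i, IsSing M (e i)) {x y : Fin 5 → k}
    (hx : ∀ i, x i ≠ 0) (hy : ∀ i, y i ≠ 0)
    (h : IsSing M (∑ i, x i • e i)) (h' : IsSing M (∑ i, y i • e i)) :
    ∃ c : k, y = c • x := by
  by_contra hne
  have h1 := (isSing_inv_iff hV he hs (y := fun i => (x i)⁻¹) (by simpa)).1 (by simpa)
  have h2 := (isSing_inv_iff hV he hs (y := fun i => (y i)⁻¹) (by simpa)).1 (by simpa)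
  refine false_of_inverted_pencil hM he hx hy hne fun t ht => (isSing_inv_iff hV he hs ht).2 ?_
  obtain ⟨c, d0, d1, d2, d3, d4⟩ := h1
  obtain ⟨c', d0', d1', d2', d3', d4'⟩ := h2
  refine ⟨?_, ?_, ?_, ?_, ?_, ?_⟩
  -- The cross term of `Q` along the pencil is `∑ (y i)⁻¹ * ∂ᵢQ` evaluated at `1 / x`, which
  -- vanishes: the vertex set of a quadric is linear.
  · linear_combination c + t ^ 2 * c' + t * ((y 0)⁻¹ * d0 + (y 1)⁻¹ * d1 + (y 2)⁻¹ * d2 +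
      (y 3)⁻¹ * d3 + (y 4)⁻¹ * d4)
  · linear_combination d0 + t * d0'
  · linear_combination d1 + t * d1'
  · linear_combination d2 + t * d2'
  · linear_combination d3 + t * d3'
  · linear_combination d4 + t * d4'

end CubicMap

end CubicThreefold

namespace CubicThreefold

open scoped LinearAlgebra.Projectivization

/-! ### Supports of singular points with respect to independent singular vectors -/

section Supports

variable {k V : Type*} [Field k] [AddCommGroup V] [Module k V]
variable {M : V →ₗ[k] V →ₗ[k] V →ₗ[k] k}

theorem sum_smul_eq_sum_fin {n m : ℕ} (e : Fin n → V) (x : Fin n → k) (s : Finset (Fin n))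
    (hs : ∀ i, x i ≠ 0 ↔ i ∈ s) (h : s.card = m) :
    ∑ i, x i • e i = ∑ j : Fin m, x (s.orderEmbOfFin h j) • e (s.orderEmbOfFin h j) := by
  have h1 : ∑ i, x i • e i = ∑ i ∈ s, x i • e i := by
    refine (Finset.sum_subset (Finset.subset_univ s) fun i _ hi => ?_).symm
    have : x i = 0 := by
      by_contra h0
      exact hi ((hs i).1 h0)
    rw [this, zero_smul]
  rw [h1]
  conv_lhs => rw [← Finset.map_orderEmbOfFin_univ s h]
  rw [Finset.sum_map]
  rfl

theorem support_ne_zero {n m : ℕ} {x : Fin n → k} {s : Finset (Fin n)}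
    (hs : ∀ i, x i ≠ 0 ↔ i ∈ s) (h : s.card = m) (j : Fin m) : x (s.orderEmbOfFin h j) ≠ 0 :=
  (hs _).2 (Finset.orderEmbOfFin_mem s h j)

/-- The number of nonzero coordinates of a singular point with respect to independent singular
points. -/
theorem support_card [Infinite k] (hM : (singPts M).Finite) (hV : Module.finrank k V = 5)
    {n : ℕ} {e : Fin n → V} (he : LinearIndependent k e) (hs : ∀ i, IsSing M (e i))
    {x : Fin n → k} (hx : x ≠ 0) (h : IsSing M (∑ i, x i • e i)) {s : Finset (Fin n)}
    (hxs : ∀ i, x i ≠ 0 ↔ i ∈ s) : s.card = 1 ∨ s.card = 3 ∨ s.card = 5 := by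
  have hFD : FiniteDimensional k V := FiniteDimensional.of_finrank_eq_succ hV
  have hn : n ≤ 5 := by
    have := he.fintype_card_le_finrank
    simpa [hV] using this
  have h5 : s.card ≤ 5 := (card_finset_fin_le s).trans hn
  have h0 : s.card ≠ 0 := fun h0 => hx (funext fun i => by
    by_contra hi
    have := (hxs i).1 hi
    rw [Finset.card_eq_zero.1 h0] at this
    exact absurd this (Finset.notMem_empty i))
  have h2 : s.card ≠ 2 := fun h2 => by
    rw [sum_smul_eq_sum_fin e x s hxs h2] at h
    exact no_collinear hM (he.comp _ (s.orderEmbOfFin h2).injective) (fun i => hs _)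
      (x := fun j => x (s.orderEmbOfFin h2 j)) (support_ne_zero hxs h2) h
  have h4 : s.card ≠ 4 := fun h4 => by
    rw [sum_smul_eq_sum_fin e x s hxs h4] at h
    exact no_solid hM hV (he.comp _ (s.orderEmbOfFin h4).injective) (fun i => hs _)
      (x := fun j => x (s.orderEmbOfFin h4 j)) (support_ne_zero hxs h4) h
  omega

/-- A singular point is determined by its set of nonzero coordinates. -/
theorem support_unique [Infinite k] (hM : (singPts M).Finite) (hV : Module.finrank k V = 5)
    {n : ℕ} {e : Fin n → V} (he : LinearIndependent k e) (hs : ∀ i, IsSing M (e i))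
    {x y : Fin n → k} (hx : x ≠ 0) (h : IsSing M (∑ i, x i • e i))
    (h' : IsSing M (∑ i, y i • e i)) {s : Finset (Fin n)}
    (hxs : ∀ i, x i ≠ 0 ↔ i ∈ s) (hys : ∀ i, y i ≠ 0 ↔ i ∈ s) : ∃ c : k, y = c • x := by
  have key : ∀ m (hm : s.card = m), (∃ c : k, (fun j => y (s.orderEmbOfFin hm j)) =
      c • fun j => x (s.orderEmbOfFin hm j)) → ∃ c : k, y = c • x := by
    rintro m hm ⟨c, hc⟩
    refine ⟨c, funext fun i => ?_⟩
    by_cases hi : i ∈ s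
    · rw [← Finset.mem_coe, ← Finset.range_orderEmbOfFin s hm] at hi
      obtain ⟨j, rfl⟩ := hi
      exact congrFun hc j
    · have h1 : x i = 0 := by
        by_contra h0
        exact hi ((hxs i).1 h0)
      have h2 : y i = 0 := by
        by_contra h0
        exact hi ((hys i).1 h0)
      simp [h1, h2]
  rcases support_card hM hV he hs hx h hxs with hm | hm | hm
  · refine key 1 hm ⟨y (s.orderEmbOfFin hm 0) / x (s.orderEmbOfFin hm 0), funext fun j => ?_⟩
    have := support_ne_zero hxs hm 0
    rw [Subsingleton.elim j 0]
    simp [this]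
  · rw [sum_smul_eq_sum_fin e x s hxs hm] at h
    rw [sum_smul_eq_sum_fin e y s hys hm] at h'
    exact key 3 hm (coplanar_unique hM (he.comp _ (s.orderEmbOfFin hm).injective) (fun i => hs _)
      (support_ne_zero hxs hm) (support_ne_zero hys hm) h h')
  · rw [sum_smul_eq_sum_fin e x s hxs hm] at h
    rw [sum_smul_eq_sum_fin e y s hys hm] at h'
    exact key 5 hm (generic_unique hM hV (he.comp _ (s.orderEmbOfFin hm).injective)
      (fun i => hs _) (support_ne_zero hxs hm) (support_ne_zero hys hm) h h')

variable (M) in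
/-- There is a singular vector whose set of nonzero coordinates with respect to `e` is `s`. -/
def HasSupport {n : ℕ} (e : Fin n → V) (s : Finset (Fin n)) : Prop :=
  ∃ x : Fin n → k, (∀ i, x i ≠ 0 ↔ i ∈ s) ∧ IsSing M (∑ i, x i • e i)

theorem HasSupport.comp_perm {n : ℕ} {e : Fin n → V} {s : Finset (Fin n)}
    (h : HasSupport M e s) (π : Equiv.Perm (Fin n)) :
    HasSupport M (e ∘ π) (s.map π.symm.toEmbedding) := by
  obtain ⟨x, hx, hs⟩ := h
  refine ⟨x ∘ π, fun i => ?_, ?_⟩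
  · simp only [Function.comp, hx, Finset.mem_map_equiv, Equiv.symm_symm]
  · rwa [← Equiv.sum_comp π] at hs

theorem HasSupport.scale {n : ℕ} {e : Fin n → V} {s : Finset (Fin n)}
    (h : HasSupport M e s) {u : Fin n → k} (hu : ∀ i, u i ≠ 0) :
    HasSupport M (fun i => u i • e i) s := by
  obtain ⟨x, hx, hs⟩ := h
  refine ⟨fun i => x i / u i, fun i => ?_, ?_⟩
  · simp only [← hx, div_ne_zero_iff]
    exact ⟨fun h => h.1, fun h => ⟨h, hu i⟩⟩
  · simpa [smul_smul, hu] using hs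

/-- The singular points of a cubic threefold with nine of them span, and their supports with
respect to five of them are pairwise distinct. -/
theorem exists_singular_basis [Infinite k] (hM : (singPts M).ncard = 9)
    (hV : Module.finrank k V = 5) : ∃ e : Fin 5 → V, LinearIndependent k e ∧
      (∀ i, IsSing M (e i)) ∧ ∃ T : Finset (Finset (Fin 5)), 4 ≤ T.card ∧
        ∀ s ∈ T, (s.card = 3 ∨ s.card = 5) ∧ HasSupport M e s := by
  classical
  have hFD : FiniteDimensional k V := FiniteDimensional.of_finrank_eq_succ hV
  have hfin : (singPts M).Finite := Set.finite_of_ncard_ne_zero (by omega)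
  let P : ℕ → Prop := fun n => ∃ e : Fin n → V, LinearIndependent k e ∧ ∀ i, IsSing M (e i)
  have hPle : ∀ n, P n → n ≤ 5 := by
    rintro n ⟨e, he, -⟩
    have := he.fintype_card_le_finrank
    simpa [hV] using this
  have hP0 : P 0 := ⟨Fin.elim0, linearIndependent_empty_type, fun i => i.elim0⟩
  -- A maximal independent family of singular vectors: every singular vector lies in its span and so
  -- has a support.
  let n := Nat.findGreatest P 5
  have hn : P n := Nat.findGreatest_spec (Nat.zero_le 5) hP0
  have hn1 : ¬ P (n + 1) := fun h => by
    have := Nat.le_findGreatest (hPle _ h) h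
    change n + 1 ≤ n at this
    omega
  have hn5 : n ≤ 5 := hPle n hn
  clear_value n
  obtain ⟨e, he, hs⟩ := hn
  have hspan : ∀ p ∈ singPts M, ∃ x : Fin n → k, p.rep = ∑ i, x i • e i := by
    intro p hp
    by_contra! hcon
    refine hn1 ⟨Fin.snoc e p.rep, linearIndependent_finSnoc.2 ⟨he, fun hm => ?_⟩, fun i => ?_⟩
    · obtain ⟨x, hx⟩ := (Submodule.mem_span_range_iff_exists_fun k).1 hm
      exact hcon x hx.symm
    · refine Fin.lastCases ?_ (fun i => ?_) i
      · rw [Fin.snoc_last]; exact hp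
      · simpa using hs i
  choose! x hx using hspan
  have hx0 : ∀ p ∈ singPts M, x p ≠ 0 := fun p hp h0 => p.rep_nonzero (by simp [hx p hp, h0])
  have hsing : ∀ p ∈ singPts M, IsSing M (∑ i, x p i • e i) := fun p hp => by
    rw [← hx p hp]; exact hp
  let f : ℙ k V → Finset (Fin n) := fun p => Finset.univ.filter fun i => x p i ≠ 0
  have hf : ∀ p i, x p i ≠ 0 ↔ i ∈ f p := fun p i => by simp [f]
  have hinj : Set.InjOn f (singPts M) := by
    intro p hp q hq hpq
    obtain ⟨c, hc⟩ := support_unique hfin hV he hs (hx0 p hp) (hsing p hp) (hsing q hq) (hf p)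
      (fun i => by rw [hf q, hpq])
    rw [← p.mk_rep, ← q.mk_rep, Projectivization.mk_eq_mk_iff']
    have hqp : q.rep = c • p.rep := by
      rw [hx q hq, hx p hp, hc, Finset.smul_sum]
      simp [smul_smul]
    have hc0 : c ≠ 0 := by
      rintro rfl
      exact q.rep_nonzero (by simpa using hqp)
    exact ⟨c⁻¹, by rw [hqp, smul_smul, inv_mul_cancel₀ hc0, one_smul]⟩
  let S : Finset (Finset (Fin n)) := hfin.toFinset.image f
  have hS : S.card = 9 := by
    rw [Finset.card_image_of_injOn (by simpa using hinj), ← Set.ncard_eq_toFinset_card _ hfin, hM]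
  have hSmem : ∀ s ∈ S, (s.card = 1 ∨ s.card = 3 ∨ s.card = 5) ∧ HasSupport M e s := by
    intro s hs'
    obtain ⟨p, hp, rfl⟩ := Finset.mem_image.1 hs'
    rw [Set.Finite.mem_toFinset] at hp
    exact ⟨support_card hfin hV he hs (hx0 p hp) (hsing p hp) (hf p), x p, hf p, hsing p hp⟩
  have hle : S.card ≤ (Finset.univ.filter fun s : Finset (Fin n) =>
      s.card = 1 ∨ s.card = 3 ∨ s.card = 5).card :=
    Finset.card_le_card fun s hs' => Finset.mem_filter.2 ⟨Finset.mem_univ s, (hSmem s hs').1⟩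
  rw [hS] at hle
  have hn' : n = 5 := by
    clear * - hn5 hle
    interval_cases n
    any_goals (exfalso; revert hle; decide)
    rfl
  subst hn'
  refine ⟨e, he, hs, S.filter fun s => s.card ≠ 1, ?_, fun s hs' => ?_⟩
  · have h1 : (S.filter fun s => s.card = 1).card ≤ 5 := by
      refine (Finset.card_le_card (t := Finset.univ.filter fun s : Finset (Fin 5) => s.card = 1)
        fun s hs' => ?_).trans (by decide)
      simpa using (Finset.mem_filter.1 hs').2
    have h2 := Finset.card_filter_add_card_filter_not (s := S) (fun s => s.card = 1)
    simp only [ne_eq] at *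
    omega
  · obtain ⟨h1, h2⟩ := Finset.mem_filter.1 hs'
    exact ⟨(hSmem s h1).1.resolve_left h2, (hSmem s h1).2⟩

end Supports

end CubicThreefold

namespace CubicThreefold

open scoped LinearAlgebra.Projectivization

/-! ### Reduction to a hyperplane section of the Perazzo cubic -/

section NormalForm

variable {k V : Type*} [Field k] [AddCommGroup V] [Module k V]
variable {M : V →ₗ[k] V →ₗ[k] V →ₗ[k] k}

variable (M) in
/-- A presentation of a cubic as a hyperplane section of the Perazzo cubic
`α l₀ l₁ l₂ = β m₀ m₁ m₂`. -/
structure NormalForm where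
  /-- The first three linear forms. -/
  l : Fin 3 → V →ₗ[k] k
  /-- The last three linear forms. -/
  m : Fin 3 → V →ₗ[k] k
  /-- The coefficient of the first product. -/
  α : k
  /-- The coefficient of the second product. -/
  β : k
  hα : α ≠ 0
  hβ : β ≠ 0
  cub_eq : ∀ v, cub M v = α * (l 0 v * l 1 v * l 2 v) - β * (m 0 v * m 1 v * m 2 v)
  sum_eq : ∀ v, l 0 v + l 1 v + l 2 v = m 0 v + m 1 v + m 2 v
  sep : ∀ v, (∀ i, l i v = 0) → (∀ i, m i v = 0) → v = 0

/-- The linear form with coefficients `c` with respect to the basis `b`. -/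
noncomputable def linForm (b : Module.Basis (Fin 5) k V) (c : Fin 5 → k) : V →ₗ[k] k :=
  ∑ i, c i • b.coord i

theorem linForm_apply (b : Module.Basis (Fin 5) k V) (c : Fin 5 → k) (v : V) :
    linForm b c v = c 0 * b.repr v 0 + c 1 * b.repr v 1 + c 2 * b.repr v 2 + c 3 * b.repr v 3 +
      c 4 * b.repr v 4 := by
  simp [linForm, Fin.sum_univ_five]

theorem exists_normalForm_of_polynomial (b : Module.Basis (Fin 5) k V) (l m : Fin 3 → Fin 5 → k)
    {α β : k} (hα : α ≠ 0) (hβ : β ≠ 0)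
    (h : ∀ x : Fin 5 → k, cub M (∑ i, x i • b i) = α * (∏ i, ∑ j, l i j * x j) -
      β * ∏ i, ∑ j, m i j * x j)
    (hsum : ∀ j, l 0 j + l 1 j + l 2 j = m 0 j + m 1 j + m 2 j)
    (hsep : ∀ x : Fin 5 → k, (∀ i, ∑ j, l i j * x j = 0) → (∀ i, ∑ j, m i j * x j = 0) → x = 0) :
    Nonempty (NormalForm M) := by
  refine ⟨⟨fun i => linForm b (l i), fun i => linForm b (m i), α, β, hα, hβ, fun v => ?_,
    fun v => ?_, fun v h1 h2 => ?_⟩⟩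
  · have := h (b.repr v)
    rw [b.sum_repr] at this
    simpa [linForm_apply, Fin.prod_univ_three, Fin.sum_univ_five] using this
  · simp only [linForm_apply]
    linear_combination b.repr v 0 * hsum 0 + b.repr v 1 * hsum 1 + b.repr v 2 * hsum 2 +
      b.repr v 3 * hsum 3 + b.repr v 4 * hsum 4
  · have := hsep (b.repr v) (fun i => by simpa [linForm_apply, Fin.sum_univ_five] using h1 i)
      (fun i => by simpa [linForm_apply, Fin.sum_univ_five] using h2 i)
    exact b.repr.map_eq_zero_iff.1 (Finsupp.ext fun i => congrFun this i)

/-- Five independent singular points `e` such that `e 0 + e 1 + e 2` and `e 0 + e 1 + e 3` are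
singular as well. -/
structure IsFrame (M : V →ₗ[k] V →ₗ[k] V →ₗ[k] k) (e : Fin 5 → V) : Prop where
  indep : LinearIndependent k e
  sing : ∀ i, IsSing M (e i)
  sing_left : IsSing M (∑ i, (![1, 1, 1, 0, 0] : Fin 5 → k) i • e i)
  sing_right : IsSing M (∑ i, (![1, 1, 0, 1, 0] : Fin 5 → k) i • e i)

theorem exists_isFrame [Infinite k] (hM : (singPts M).Finite) (hV : Module.finrank k V = 5)
    {e : Fin 5 → V} (he : LinearIndependent k e) (hs : ∀ i, IsSing M (e i))
    (h2 : HasSupport M e {0, 1, 2}) (h3 : HasSupport M e {0, 1, 3}) :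
    ∃ u : Fin 5 → k, (∀ i, u i ≠ 0) ∧ IsFrame M (fun i => u i • e i) := by
  obtain ⟨x, hx, hxs⟩ := h2
  obtain ⟨y, hy, hys⟩ := h3
  have x0 : x 0 ≠ 0 := (hx 0).2 (by decide)
  have x1 : x 1 ≠ 0 := (hx 1).2 (by decide)
  have x2 : x 2 ≠ 0 := (hx 2).2 (by decide)
  have x3 : x 3 = 0 := by simpa using (hx 3).not
  have x4 : x 4 = 0 := by simpa using (hx 4).not
  have y0 : y 0 ≠ 0 := (hy 0).2 (by decide)
  have y1 : y 1 ≠ 0 := (hy 1).2 (by decide)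
  have y2 : y 2 = 0 := by simpa using (hy 2).not
  have y3 : y 3 ≠ 0 := (hy 3).2 (by decide)
  have y4 : y 4 = 0 := by simpa using (hy 4).not
  have hp := (isSing_comb5_iff hV he hs x).1 hxs
  have hq := (isSing_comb5_iff hV he hs y).1 hys
  simp only [x3, x4, y2, y4, mul_zero, zero_mul, add_zero, zero_add] at hp hq
  obtain ⟨-, -, -, p2, p3, -⟩ := hp
  obtain ⟨-, -, -, q2, q3, -⟩ := hq
  have a2 : pol M (e 0) (e 1) (e 2) = 0 := by simpa [x0, x1] using p2
  have a3 : pol M (e 0) (e 1) (e 3) = 0 := by simpa [y0, y1] using q3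
  have a23 : pol M (e 0) (e 2) (e 3) ≠ 0 := fun h0 => by
    refine false_of_solid hM hV (he.comp Fin.castSucc (Fin.castSucc_injective 4)) (fun i => hs _)
      a2 a3 h0 ?_
    rw [a3, h0] at p3
    simpa [x1, x2] using p3
  -- The `e 3`-derivative at the first point and the `e 2`-derivative at the second both determine
  -- the ratio of the coefficients of `(0,2,3)` and `(1,2,3)`. So the two points agree in the ratio
  -- of their first two coordinates, and one rescaling normalizes both.
  have hr : x 0 * y 1 = x 1 * y 0 := by
    refine mul_left_cancel₀ (mul_ne_zero (mul_ne_zero a23 x2) y3) ?_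
    rw [a3] at p3
    rw [a2] at q2
    linear_combination y 1 * y 3 * p3 - x 1 * x 2 * q2
  have hu : ∀ i, (![x 0, x 1, x 2, y 3 * x 0 / y 0, 1] : Fin 5 → k) i ≠ 0 := by
    intro i
    fin_cases i <;> simp [x0, x1, x2, y0, y3]
  refine ⟨![x 0, x 1, x 2, y 3 * x 0 / y 0, 1], hu, he.units_smul fun i => Units.mk0 _ (hu i),
    fun i => (hs i).smul _, ?_, ?_⟩
  · convert hxs using 1
    simp [Fin.sum_univ_five, x3, x4]
  · convert hys.smul (x 0 / y 0) using 1
    have h1 : x 0 / y 0 * y 1 = x 1 := by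
      field_simp
      linear_combination hr
    simp [Fin.sum_univ_five, y2, y4, smul_smul, h1, y0]
    congr 2
    ring

/-- The two extra singular points leave five free coefficients, those of `(0,2,3)`, `(0,1,4)`,
`(0,2,4)`, `(0,3,4)` and `(2,3,4)`. If the first vanished, the cubic would contain the solid spanned
by `e 0, …, e 3`; if the second did, the line `e 0 + e 1 + t • e 4` would be singular. -/
theorem IsFrame.relations [Infinite k] (hM : (singPts M).Finite) (hV : Module.finrank k V = 5)
    {e : Fin 5 → V} (h : IsFrame M e) :
    pol M (e 0) (e 1) (e 2) = 0 ∧ pol M (e 0) (e 1) (e 3) = 0 ∧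
    pol M (e 1) (e 2) (e 3) = - pol M (e 0) (e 2) (e 3) ∧
    pol M (e 1) (e 2) (e 4) = - pol M (e 0) (e 1) (e 4) - pol M (e 0) (e 2) (e 4) ∧
    pol M (e 1) (e 3) (e 4) = - pol M (e 0) (e 1) (e 4) - pol M (e 0) (e 3) (e 4) ∧
    pol M (e 0) (e 2) (e 3) ≠ 0 ∧ pol M (e 0) (e 1) (e 4) ≠ 0 := by
  have hp := (isSing_comb5_iff hV h.indep h.sing _).1 h.sing_left
  have hq := (isSing_comb5_iff hV h.indep h.sing _).1 h.sing_right
  simp only [Matrix.cons_val_zero, Matrix.cons_val_one, Matrix.cons_val, mul_zero, zero_mul,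
    add_zero, zero_add, one_mul] at hp hq
  obtain ⟨-, -, -, p2, p3, p4⟩ := hp
  obtain ⟨-, -, -, q2, q3, q4⟩ := hq
  have a23 : pol M (e 1) (e 2) (e 3) = - pol M (e 0) (e 2) (e 3) := by
    linear_combination p3 - q3
  have a0 : pol M (e 0) (e 2) (e 3) ≠ 0 := fun h0 =>
    false_of_solid hM hV (h.indep.comp Fin.castSucc (Fin.castSucc_injective 4)) (fun i => h.sing _)
      p2 q3 h0 (a23.trans (by rw [h0, neg_zero]))
  have b2 : pol M (e 1) (e 2) (e 4) = - pol M (e 0) (e 1) (e 4) - pol M (e 0) (e 2) (e 4) := by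
    linear_combination p4
  have b3 : pol M (e 1) (e 3) (e 4) = - pol M (e 0) (e 1) (e 4) - pol M (e 0) (e 3) (e 4) := by
    linear_combination q4
  refine ⟨p2, q3, a23, b2, b3, a0, fun h0 => ?_⟩
  refine false_of_family hM (fun t => ∑ i, (![1, 1, 0, 0, t] : Fin 5 → k) i • e i) ∅
    Set.finite_empty (fun t _ => coords_ne_zero h.indep 0 (by simp))
    (fun t _ => (isSing_comb5_iff hV h.indep h.sing _).2 ?_) ?_
  · simp [p2, q3, h0, b2, b3]
  · intro s _ t _ c hc
    simp only [Finset.smul_sum, smul_smul] at hc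
    have h1 := fun i => congrFun (coords_unique h.indep hc) i
    have h0 := h1 0
    have h4 := h1 4
    simp at h0 h4
    rw [h4, ← h0, one_mul]

/-- On each of these coordinate planes the cubic is a single monomial with nonzero coefficient. -/
theorem IsFrame.not_hasSupport [Infinite k] (hM : (singPts M).Finite)
    (hV : Module.finrank k V = 5) {e : Fin 5 → V} (h : IsFrame M e) :
    ¬ HasSupport M e {0, 1, 4} ∧ ¬ HasSupport M e {0, 2, 3} ∧ ¬ HasSupport M e {1, 2, 3} := by
  obtain ⟨p2, q3, a23, b2, b3, a0, A0⟩ := h.relations hM hV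
  refine ⟨?_, ?_, ?_⟩
  · rintro ⟨x, hx, hxs⟩
    have x0 : x 0 ≠ 0 := (hx 0).2 (by decide)
    have x1 : x 1 ≠ 0 := (hx 1).2 (by decide)
    have x2 : x 2 = 0 := by simpa using (hx 2).not
    have x3 : x 3 = 0 := by simpa using (hx 3).not
    have x4 : x 4 ≠ 0 := (hx 4).2 (by decide)
    have := ((isSing_comb5_iff hV h.indep h.sing x).1 hxs).1
    simp [x0, x1, x2, x3, x4, A0] at this
  · rintro ⟨x, hx, hxs⟩
    have x0 : x 0 ≠ 0 := (hx 0).2 (by decide)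
    have x1 : x 1 = 0 := by simpa using (hx 1).not
    have x2 : x 2 ≠ 0 := (hx 2).2 (by decide)
    have x3 : x 3 ≠ 0 := (hx 3).2 (by decide)
    have x4 : x 4 = 0 := by simpa using (hx 4).not
    have := ((isSing_comb5_iff hV h.indep h.sing x).1 hxs).1
    simp [x0, x1, x2, x3, x4, a0] at this
  · rintro ⟨x, hx, hxs⟩
    have x0 : x 0 = 0 := by simpa using (hx 0).not
    have x1 : x 1 ≠ 0 := (hx 1).2 (by decide)
    have x2 : x 2 ≠ 0 := (hx 2).2 (by decide)
    have x3 : x 3 ≠ 0 := (hx 3).2 (by decide)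
    have x4 : x 4 = 0 := by simpa using (hx 4).not
    have := ((isSing_comb5_iff hV h.indep h.sing x).1 hxs).1
    simp [x0, x1, x2, x3, x4, a0, a23] at this

/-- In inverted coordinates the linear equations make the first four coordinates equal, and the
quadric then reduces to this relation. -/
theorem IsFrame.generic_relation [Infinite k] (hM : (singPts M).Finite)
    (hV : Module.finrank k V = 5) {e : Fin 5 → V} (h : IsFrame M e)
    (hu : HasSupport M e Finset.univ) :
    pol M (e 2) (e 3) (e 4) = pol M (e 0) (e 1) (e 4) := by
  obtain ⟨p2, q3, a23, b2, b3, a0, A0⟩ := h.relations hM hV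
  obtain ⟨y, hy, hys⟩ := hu
  have y0 : ∀ i, y i ≠ 0 := fun i => (hy i).2 (Finset.mem_univ i)
  have hG := (isSing_inv_iff hV h.indep h.sing (y := fun i => (y i)⁻¹) (by simpa)).1 (by simpa)
  have z0 : (y 0)⁻¹ ≠ 0 := inv_ne_zero (y0 0)
  simp only [p2, q3, a23, b2, b3] at hG
  obtain ⟨g, -, -, g2, g3, g4⟩ := hG
  have e1 : (y 1)⁻¹ = (y 0)⁻¹ := mul_right_cancel₀ a0 (by linear_combination g4)
  rw [e1] at g g2 g3
  have e2 : (y 2)⁻¹ = (y 0)⁻¹ := mul_right_cancel₀ A0 (by linear_combination g3)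
  have e3 : (y 3)⁻¹ = (y 0)⁻¹ := mul_right_cancel₀ A0 (by linear_combination g2)
  rw [e2, e3] at g
  refine mul_left_cancel₀ (mul_ne_zero z0 z0) ?_
  linear_combination g

theorem IsFrame.not_hasSupport_univ [Infinite k] (hM : (singPts M).Finite)
    (hV : Module.finrank k V = 5) {e : Fin 5 → V} (h : IsFrame M e)
    (h1 : HasSupport M e {2, 3, 4}) : ¬ HasSupport M e Finset.univ := by
  obtain ⟨p2, q3, a23, b2, b3, a0, A0⟩ := h.relations hM hV
  obtain ⟨x, hx, hxs⟩ := h1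
  intro hu
  have hd := ((isSing_comb5_iff hV h.indep h.sing x).1 hxs).1
  have x0 : x 0 = 0 := by simpa using (hx 0).not
  have x1 : x 1 = 0 := by simpa using (hx 1).not
  have x2 : x 2 ≠ 0 := (hx 2).2 (by decide)
  have x3 : x 3 ≠ 0 := (hx 3).2 (by decide)
  have x4 : x 4 ≠ 0 := (hx 4).2 (by decide)
  simp [x0, x1, x2, x3, x4, h.generic_relation hM hV hu, A0] at hd

theorem IsFrame.exists_normalForm_of_024 [Infinite k] (hM : (singPts M).Finite)
    (hV : Module.finrank k V = 5) {e : Fin 5 → V} (h : IsFrame M e)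
    (h1 : HasSupport M e {0, 2, 4})
    (h2 : HasSupport M e {0, 3, 4} ∨ HasSupport M e {1, 2, 4} ∨ HasSupport M e {1, 3, 4} ∨
      HasSupport M e {2, 3, 4} ∨ HasSupport M e Finset.univ) : Nonempty (NormalForm M) := by
  have hFD : FiniteDimensional k V := FiniteDimensional.of_finrank_eq_succ hV
  obtain ⟨p2, q3, a23, b2, b3, a0, A0⟩ := h.relations hM hV
  have hgen := h.generic_relation hM hV
  have hF := cub_comb5 h.sing
  -- At the node supported on `{0, 2, 4}` the cubic gives the first claim and the `e 1`-derivative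
  -- gives `x 0 = x 2`. The `e 3`-derivative would then force the coefficient of `(0,2,3)` to vanish
  -- if the sum were zero.
  obtain ⟨hb, hcd⟩ : pol M (e 0) (e 2) (e 4) = 0 ∧
      pol M (e 0) (e 3) (e 4) + pol M (e 2) (e 3) (e 4) ≠ 0 := by
    obtain ⟨x, hx, hxs⟩ := h1
    have x0 : x 0 ≠ 0 := (hx 0).2 (by decide)
    have x1 : x 1 = 0 := by simpa using (hx 1).not
    have x2 : x 2 ≠ 0 := (hx 2).2 (by decide)
    have x3 : x 3 = 0 := by simpa using (hx 3).not
    have x4 : x 4 ≠ 0 := (hx 4).2 (by decide)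
    obtain ⟨d, -, d1, -, d3, -⟩ := (isSing_comb5_iff hV h.indep h.sing x).1 hxs
    have hb : pol M (e 0) (e 2) (e 4) = 0 := by
      simpa [x0, x1, x2, x3, x4] using d
    simp only [x1, x3, p2, q3, b2, hb] at d1 d3
    have e02 : x 0 = x 2 := by
      refine mul_left_cancel₀ (mul_ne_zero A0 x4) ?_
      linear_combination d1
    refine ⟨hb, fun h0 => ?_⟩
    rw [← e02] at d3
    refine a0 (mul_left_cancel₀ (mul_ne_zero x0 x0) ?_)
    linear_combination d3 - x 0 * x 4 * h0
  let b := basisOfLinearIndependentOfCardEqFinrank h.indep (by simp [hV])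
  have hbe : ∀ i, b i = e i := fun i => by simp [b]
  -- Each further support yields one relation. Support `{1, 2, 4}` is impossible, because its
  -- coefficient is now minus that of `(0,1,4)`.
  have h3 : pol M (e 0) (e 3) (e 4) = 0 ∨ pol M (e 1) (e 3) (e 4) = 0 ∨
      pol M (e 2) (e 3) (e 4) = 0 ∨ pol M (e 2) (e 3) (e 4) = pol M (e 0) (e 1) (e 4) := by
    rcases h2 with ⟨x, hx, hxs⟩ | ⟨x, hx, hxs⟩ | ⟨x, hx, hxs⟩ | ⟨x, hx, hxs⟩ | hu
    on_goal 5 => exact Or.inr (Or.inr (Or.inr (hgen hu)))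
    all_goals
      have hd := ((isSing_comb5_iff hV h.indep h.sing x).1 hxs).1
      have k0 := hx 0
      have k1 := hx 1
      have k2 := hx 2
      have k3 := hx 3
      have k4 := hx 4
      simp at k0 k1 k2 k3 k4
      simp [k0, k1, k2, k3, k4, b2, hb, A0] at hd <;> tauto
  rw [hb] at b2
  simp only [p2, q3, a23, b2, b3, hb] at hF
  simp only [b3] at h3
  generalize pol M (e 0) (e 2) (e 3) = a at *
  generalize pol M (e 0) (e 1) (e 4) = A at *
  generalize pol M (e 0) (e 3) (e 4) = c at *
  generalize pol M (e 2) (e 3) (e 4) = d at *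
  rcases h3 with rfl | h3 | rfl | rfl
  -- Here the cubic is `x₂x₃(ax₀ - ax₁ + dx₄) + Ax₁x₄(x₀ - x₂ - x₃)`. In all four cases the factors
  -- are scaled so that the two triples of forms have equal sums, and `α`, `β` compensate for the
  -- scaling.
  · rw [zero_add] at hcd
    refine exists_normalForm_of_polynomial b (α := 1 / a ^ 2) (β := A / (d * a ^ 2))
      ![![a, -a, 0, 0, d], ![0, 0, -a, 0, 0], ![0, 0, 0, -a, 0]]
      ![![0, 0, 0, 0, d], ![0, -a, 0, 0, 0], ![a, 0, -a, -a, 0]]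
      (by simp [a0]) (by simp [A0, hcd, a0]) (fun x => ?_) (fun j => ?_) (fun x hl hm => ?_)
    · simp only [hbe, hF]
      simp [Fin.prod_univ_three, Fin.sum_univ_five]
      field_simp
      ring
    · fin_cases j <;> simp
    · have l0 := hl 0
      have l1 := hl 1
      have l2 := hl 2
      have m0 := hm 0
      have m1 := hm 1
      simp [Fin.sum_univ_five, a0, hcd] at l1 l2 m0 m1
      simp [Fin.sum_univ_five, a0, l1, l2, m0, m1] at l0
      funext i
      fin_cases i <;> simp [l0, l1, l2, m0, m1]
  -- Here the cubic is `x₂x₃(ax₀ - ax₁ + (d - A)x₄) + Ax₄(x₀ - x₂)(x₁ - x₃)`.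
  · obtain rfl : c = -A := by linear_combination -h3
    have hdA : d - A ≠ 0 := fun h0 => hcd (by linear_combination h0)
    refine exists_normalForm_of_polynomial b (α := -1 / a ^ 2) (β := A / ((d - A) * a ^ 2))
      ![![a, -a, 0, 0, d - A], ![0, 0, -a, 0, 0], ![0, 0, 0, a, 0]]
      ![![0, 0, 0, 0, d - A], ![a, 0, -a, 0, 0], ![0, -a, 0, a, 0]]
      (by simp [a0]) (by simp [A0, hdA, a0]) (fun x => ?_) (fun j => ?_) (fun x hl hm => ?_)
    · simp only [hbe, hF]
      simp [Fin.prod_univ_three, Fin.sum_univ_five]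
      field_simp
      ring
    · fin_cases j <;> simp
    · have l1 := hl 1
      have l2 := hl 2
      have m0 := hm 0
      have m1 := hm 1
      have m2 := hm 2
      simp [Fin.sum_univ_five, a0, hdA] at l1 l2 m0
      simp [Fin.sum_univ_five, a0, l1, l2, m0] at m1 m2
      funext i
      fin_cases i <;> simp [l1, l2, m0, m1, m2]
  -- Here the cubic is `x₃(x₀ - x₁)(ax₂ + cx₄) + Ax₁x₄(x₀ - x₂ - x₃)`.
  · rw [add_zero] at hcd
    refine exists_normalForm_of_polynomial b (α := 1 / a ^ 2) (β := -A / (c * a ^ 2))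
      ![![a, -a, 0, 0, 0], ![0, 0, 0, -a, 0], ![0, 0, -a, 0, -c]]
      ![![a, 0, -a, -a, 0], ![0, -a, 0, 0, 0], ![0, 0, 0, 0, -c]]
      (by simp [a0]) (by simp [A0, hcd, a0]) (fun x => ?_) (fun j => ?_) (fun x hl hm => ?_)
    · simp only [hbe, hF]
      simp [Fin.prod_univ_three, Fin.sum_univ_five]
      field_simp
      ring
    · fin_cases j <;> simp
    · have l0 := hl 0
      have l1 := hl 1
      have l2 := hl 2
      have m1 := hm 1
      have m2 := hm 2
      simp [Fin.sum_univ_five, a0, hcd] at l1 m1 m2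
      simp [Fin.sum_univ_five, a0, l1, m1, m2] at l0 l2
      funext i
      fin_cases i <;> simp [l0, l1, l2, m1, m2]
  -- Here the cubic is `x₃(x₀ - x₁)(ax₂ + (c + d)x₄) + dx₄(x₀ - x₂)(x₁ - x₃)`, with `A = d`.
  · refine exists_normalForm_of_polynomial b (α := -1 / a ^ 2) (β := -d / ((c + d) * a ^ 2))
      ![![a, -a, 0, 0, 0], ![0, 0, 0, a, 0], ![0, 0, -a, 0, -(c + d)]]
      ![![a, 0, -a, 0, 0], ![0, -a, 0, a, 0], ![0, 0, 0, 0, -(c + d)]]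
      (by simp [a0]) (by simp [A0, hcd, a0]) (fun x => ?_) (fun j => ?_) (fun x hl hm => ?_)
    · simp only [hbe, hF]
      simp [Fin.prod_univ_three, Fin.sum_univ_five]
      field_simp
      ring
    · fin_cases j <;> simp
    · have l1 := hl 1
      have l2 := hl 2
      have m0 := hm 0
      have m1 := hm 1
      have m2 := hm 2
      simp only [Fin.sum_univ_five, Matrix.cons_val_zero, Matrix.cons_val_one, Matrix.cons_val,
        zero_mul, add_zero, zero_add] at l1 l2 m0 m1 m2
      have x3 : x 3 = 0 := by simpa [a0] using l1
      have x4 : x 4 = 0 := (mul_eq_zero.1 m2).resolve_left (neg_ne_zero.2 hcd)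
      have x2 : x 2 = 0 := by simpa [x4, a0] using l2
      have x0 : x 0 = 0 := by simpa [x2, a0] using m0
      have x1 : x 1 = 0 := by simpa [x3, a0] using m1
      funext i
      fin_cases i <;> simp [x0, x1, x2, x3, x4]

theorem exists_perm_of_triples {s t : Finset (Fin 5)} (hs : s.card = 3) (ht : t.card = 3)
    (hst : (s ∩ t).card = 2) : ∃ π : Equiv.Perm (Fin 5),
      s = ({0, 1, 2} : Finset (Fin 5)).map π.toEmbedding ∧
      t = ({0, 1, 3} : Finset (Fin 5)).map π.toEmbedding := by
  obtain ⟨i, j, hij, h1⟩ := Finset.card_eq_two.1 hst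
  have h2 : (s \ t).card = 1 := by
    have := Finset.card_sdiff_add_card_inter s t
    omega
  have h3 : (t \ s).card = 1 := by
    have := Finset.card_sdiff_add_card_inter t s
    rw [Finset.inter_comm] at this
    omega
  obtain ⟨a, ha⟩ := Finset.card_eq_one.1 h2
  obtain ⟨b, hb⟩ := Finset.card_eq_one.1 h3
  have hs' : s = {i, j, a} := by
    rw [← Finset.sdiff_union_inter s t, h1, ha, Finset.union_comm]
    ext
    simp
  have ht' : t = {i, j, b} := by
    rw [← Finset.sdiff_union_inter t s, Finset.inter_comm, h1, hb, Finset.union_comm]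
    ext
    simp
  obtain ⟨c, hc⟩ : ∃ c, c ∉ ({i, j, a, b} : Finset (Fin 5)) := by
    by_contra! hcon
    have h4 : ({i, j, a, b} : Finset (Fin 5)) = Finset.univ := Finset.eq_univ_iff_forall.2 hcon
    have h5 : ({i, j, a, b} : Finset (Fin 5)).card ≤ 4 := Finset.card_le_four
    rw [h4] at h5
    simp at h5
  have hiS : i ∈ s ∩ t := by simp [h1]
  have hjS : j ∈ s ∩ t := by simp [h1]
  have haS : a ∈ s \ t := by simp [ha]
  have hbS : b ∈ t \ s := by simp [hb]
  simp only [Finset.mem_inter, Finset.mem_sdiff] at hiS hjS haS hbS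
  simp only [Finset.mem_insert, Finset.mem_singleton, not_or] at hc
  have hinj : Function.Injective ![i, j, a, b, c] := by
    have e1 : i ≠ a := fun h => haS.2 (h ▸ hiS.2)
    have e2 : i ≠ b := fun h => hbS.2 (h ▸ hiS.1)
    have e3 : j ≠ a := fun h => haS.2 (h ▸ hjS.2)
    have e4 : j ≠ b := fun h => hbS.2 (h ▸ hjS.1)
    have e5 : a ≠ b := fun h => hbS.2 (h ▸ haS.1)
    have e6 := hc.1
    have e7 := hc.2.1
    have e8 := hc.2.2.1
    have e9 := hc.2.2.2
    intro x y hxy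
    fin_cases x <;> fin_cases y <;> simp_all
  refine ⟨Equiv.ofBijective _ (Finite.injective_iff_bijective.1 hinj), ?_, ?_⟩
  · simp [hs']
  · simp [ht']

/-- Triples in five letters always meet. If two of them meet in one letter only, they cover
everything, so the third is the union of its intersections with them; these cannot both be
singletons. -/
theorem triples_meet (s t u : Finset (Fin 5)) (hs : s.card = 3) (ht : t.card = 3) (hu : u.card = 3)
    (h1 : s ≠ t) (h2 : s ≠ u) (h3 : t ≠ u) :
    (s ∩ t).card = 2 ∨ (s ∩ u).card = 2 ∨ (t ∩ u).card = 2 := by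
  have key : ∀ s t : Finset (Fin 5), s.card = 3 → t.card = 3 → s ≠ t → (s ∩ t).card ≠ 2 →
      (s ∩ t).card = 1 := by
    intro s t hs ht hst h
    have h1 := Finset.card_union_add_card_inter s t
    have h2 := card_finset_fin_le (s ∪ t)
    have h3 : (s ∩ t).card ≠ 3 := fun h3 => by
      have h4 : s ∩ t = s := Finset.eq_of_subset_of_card_le Finset.inter_subset_left (by omega)
      have h5 : s ∩ t = t := Finset.eq_of_subset_of_card_le Finset.inter_subset_right (by omega)
      exact hst (h4.symm.trans h5)
    have h6 : (s ∩ t).card ≤ s.card := Finset.card_le_card Finset.inter_subset_left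
    omega
  by_contra! hcon
  have h4 := key s t hs ht h1 hcon.1
  have h5 := key s u hs hu h2 hcon.2.1
  have h6 := key t u ht hu h3 hcon.2.2
  have h7 := Finset.card_union_add_card_inter s t
  have h8 : s ∪ t = Finset.univ := Finset.eq_univ_of_card _ (by simp; omega)
  have h9 : u = (s ∩ u) ∪ (t ∩ u) := by
    rw [← Finset.union_inter_distrib_right, h8, Finset.univ_inter]
  have h10 := Finset.card_union_le (s ∩ u) (t ∩ u)
  rw [← h9] at h10
  omega

theorem support_cases (s : Finset (Fin 5)) (hs : s.card = 3 ∨ s.card = 5) :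
    s = {0, 1, 2} ∨ s = {0, 1, 3} ∨ s = {0, 1, 4} ∨ s = {0, 2, 3} ∨ s = {1, 2, 3} ∨
    s = {0, 2, 4} ∨ s = {0, 3, 4} ∨ s = {1, 2, 4} ∨ s = {1, 3, 4} ∨ s = {2, 3, 4} ∨
    s = Finset.univ := by
  revert s
  decide

theorem hasSupport_scale_iff {n : ℕ} {e : Fin n → V} {s : Finset (Fin n)} {u : Fin n → k}
    (hu : ∀ i, u i ≠ 0) : HasSupport M (fun i => u i • e i) s ↔ HasSupport M e s := by
  refine ⟨fun h => ?_, fun h => h.scale hu⟩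
  simpa [smul_smul, hu] using h.scale (u := fun i => (u i)⁻¹) (by simpa using hu)

theorem exists_normalForm_of_024 [Infinite k] (hM : (singPts M).Finite)
    (hV : Module.finrank k V = 5) {e : Fin 5 → V} (he : LinearIndependent k e)
    (hs : ∀ i, IsSing M (e i)) (h2 : HasSupport M e {0, 1, 2}) (h3 : HasSupport M e {0, 1, 3})
    (h4 : HasSupport M e {0, 2, 4}) {s : Finset (Fin 5)} (hsc : s.card = 3 ∨ s.card = 5)
    (h : HasSupport M e s) (n2 : s ≠ {0, 1, 2}) (n3 : s ≠ {0, 1, 3}) (n4 : s ≠ {0, 2, 4}) :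
    Nonempty (NormalForm M) := by
  obtain ⟨u, hu, hfr⟩ := exists_isFrame hM hV he hs h2 h3
  obtain ⟨k1, k2, k3⟩ := hfr.not_hasSupport hM hV
  rw [hasSupport_scale_iff hu] at k1 k2 k3
  refine hfr.exists_normalForm_of_024 hM hV (h4.scale hu) ?_
  simp only [hasSupport_scale_iff hu]
  rcases support_cases s hsc with rfl | rfl | rfl | rfl | rfl | rfl | rfl | rfl | rfl | rfl | rfl <;>
    first
    | exact absurd rfl n2
    | exact absurd rfl n3
    | exact absurd rfl n4
    | exact absurd h k1
    | exact absurd h k2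
    | exact absurd h k3
    | tauto

/-- Exchanging `0` with `1` and `2` with `3` preserves the pair of normalized triples and permutes
the four possibilities for `t` transitively, so `{0, 2, 4}` may be assumed. -/
theorem exists_normalForm_of_supports [Infinite k] (hM : (singPts M).Finite)
    (hV : Module.finrank k V = 5) {e : Fin 5 → V} (he : LinearIndependent k e)
    (hs : ∀ i, IsSing M (e i)) (h2 : HasSupport M e {0, 1, 2}) (h3 : HasSupport M e {0, 1, 3})
    {s t : Finset (Fin 5)} (hsc : s.card = 3 ∨ s.card = 5) (h : HasSupport M e s)
    (n2 : s ≠ {0, 1, 2}) (n3 : s ≠ {0, 1, 3}) (hst : s ≠ t)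
    (ht : t = {0, 2, 4} ∨ t = {0, 3, 4} ∨ t = {1, 2, 4} ∨ t = {1, 3, 4}) (ht' : HasSupport M e t) :
    Nonempty (NormalForm M) := by
  have key : ∀ π : Equiv.Perm (Fin 5),
      (({0, 1, 2} : Finset (Fin 5)).map π.symm.toEmbedding = {0, 1, 2} ∧
        ({0, 1, 3} : Finset (Fin 5)).map π.symm.toEmbedding = {0, 1, 3} ∨
      ({0, 1, 2} : Finset (Fin 5)).map π.symm.toEmbedding = {0, 1, 3} ∧
        ({0, 1, 3} : Finset (Fin 5)).map π.symm.toEmbedding = {0, 1, 2}) →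
      t.map π.symm.toEmbedding = {0, 2, 4} → Nonempty (NormalForm M) := by
    intro π h1 htπ
    have g2 := h2.comp_perm π
    have g3 := h3.comp_perm π
    have g4 := ht'.comp_perm π
    have g := h.comp_perm π
    have hinj := Finset.map_injective π.symm.toEmbedding
    have m2 := hinj.ne n2
    have m3 := hinj.ne n3
    have m4 := hinj.ne hst
    rw [htπ] at g4 m4
    have hs' : ∀ i, IsSing M ((e ∘ π) i) := fun i => hs _
    rcases h1 with ⟨h1, h1'⟩ | ⟨h1, h1'⟩ <;> rw [h1] at g2 m2 <;> rw [h1'] at g3 m3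
    · exact exists_normalForm_of_024 hM hV (he.comp _ π.injective) hs' g2 g3 g4
        (by simpa using hsc) g m2 m3 m4
    · exact exists_normalForm_of_024 hM hV (he.comp _ π.injective) hs' g3 g2 g4
        (by simpa using hsc) g m3 m2 m4
  rcases ht with rfl | rfl | rfl | rfl
  · exact key 1 (by decide) (by decide)
  · exact key (Equiv.swap 2 3) (by decide) (by decide)
  · exact key (Equiv.swap 0 1) (by decide) (by decide)
  · exact key (Equiv.swap 0 1 * Equiv.swap 2 3) (by decide) (by decide)

/-- A cubic threefold with exactly nine singular points is a hyperplane section of the Perazzo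
cubic. -/
theorem exists_normalForm [Infinite k] (hM : (singPts M).ncard = 9)
    (hV : Module.finrank k V = 5) : Nonempty (NormalForm M) := by
  have hfin : (singPts M).Finite := Set.finite_of_ncard_ne_zero (by omega)
  obtain ⟨e₀, he₀, hs₀, T₀, hT₀, hT₀'⟩ := exists_singular_basis hM hV
  obtain ⟨a, ha, b, hb, hab, hab2⟩ : ∃ a ∈ T₀, ∃ b ∈ T₀, (a.card = 3 ∧ b.card = 3) ∧
      (a ∩ b).card = 2 := by
    -- The full set is the only support that is not a triple, so at least three of the four are
    -- triples.
    have h1 : 2 < (T₀.filter fun s => s.card = 3).card := by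
      have h2 := Finset.card_filter_add_card_filter_not (s := T₀) (fun s => s.card = 3)
      have h3 : (T₀.filter fun s => ¬ s.card = 3).card ≤ 1 := by
        rw [Finset.card_le_one]
        intro s hs t ht
        have h5 : ∀ s ∈ T₀.filter fun s => ¬ s.card = 3, s = Finset.univ := fun s hs => by
          obtain ⟨hs1, hs2⟩ := Finset.mem_filter.1 hs
          exact (Finset.card_eq_iff_eq_univ s).1 ((hT₀' s hs1).1.resolve_left hs2)
        rw [h5 s hs, h5 t ht]
      omega
    obtain ⟨a, ha, b, hb, c, hc, hab, hac, hbc⟩ := Finset.two_lt_card.1 h1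
    rw [Finset.mem_filter] at ha hb hc
    rcases triples_meet a b c ha.2 hb.2 hc.2 hab hac hbc with h | h | h
    · exact ⟨a, ha.1, b, hb.1, ⟨ha.2, hb.2⟩, h⟩
    · exact ⟨a, ha.1, c, hc.1, ⟨ha.2, hc.2⟩, h⟩
    · exact ⟨b, hb.1, c, hc.1, ⟨hb.2, hc.2⟩, h⟩
  obtain ⟨π, hπa, hπb⟩ := exists_perm_of_triples hab.1 hab.2 hab2
  have back : ∀ s : Finset (Fin 5), (s.map π.toEmbedding).map π.symm.toEmbedding = s := fun s => by
    ext i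
    simp
  have he : LinearIndependent k (e₀ ∘ π) := he₀.comp _ π.injective
  have hs : ∀ i, IsSing M ((e₀ ∘ π) i) := fun i => hs₀ _
  have h2 : HasSupport M (e₀ ∘ π) {0, 1, 2} := by
    have := (hT₀' a ha).2.comp_perm π
    rwa [hπa, back] at this
  have h3 : HasSupport M (e₀ ∘ π) {0, 1, 3} := by
    have := (hT₀' b hb).2.comp_perm π
    rwa [hπb, back] at this
  obtain ⟨T, hT, hT'⟩ : ∃ T : Finset (Finset (Fin 5)), 4 ≤ T.card ∧
      ∀ s ∈ T, (s.card = 3 ∨ s.card = 5) ∧ HasSupport M (e₀ ∘ π) s := by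
    refine ⟨T₀.map ⟨_, Finset.map_injective π.symm.toEmbedding⟩, by simpa using hT₀, fun s hs => ?_⟩
    obtain ⟨t, ht, rfl⟩ := Finset.mem_map.1 hs
    exact ⟨by simpa using (hT₀' t ht).1, (hT₀' t ht).2.comp_perm π⟩
  obtain ⟨u, hu, hfr⟩ := exists_isFrame hfin hV he hs h2 h3
  obtain ⟨k1, k2, k3⟩ := hfr.not_hasSupport hfin hV
  have k4 := hfr.not_hasSupport_univ hfin hV
  simp only [hasSupport_scale_iff hu] at k1 k2 k3 k4
  have hcard : 1 < ((T.erase {0, 1, 2}).erase {0, 1, 3}).card := by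
    have h1 := Finset.pred_card_le_card_erase (s := T) (a := {0, 1, 2})
    have h2 := Finset.pred_card_le_card_erase (s := T.erase {0, 1, 2}) (a := {0, 1, 3})
    omega
  obtain ⟨s, hs', t, ht', hst⟩ := Finset.one_lt_card.1 hcard
  simp only [Finset.mem_erase] at hs' ht'
  obtain ⟨ns3, ns2, hsT⟩ := hs'
  obtain ⟨nt3, nt2, htT⟩ := ht'
  obtain ⟨hsc, hsS⟩ := hT' s hsT
  obtain ⟨htc, htS⟩ := hT' t htT
  have keys : ∀ s : Finset (Fin 5), (s.card = 3 ∨ s.card = 5) → HasSupport M (e₀ ∘ π) s →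
      s ≠ {0, 1, 2} → s ≠ {0, 1, 3} →
      (s = {0, 2, 4} ∨ s = {0, 3, 4} ∨ s = {1, 2, 4} ∨ s = {1, 3, 4}) ∨
        s = {2, 3, 4} ∨ s = Finset.univ := by
    intro s hsc h n2 n3
    rcases support_cases s hsc with
      rfl | rfl | rfl | rfl | rfl | rfl | rfl | rfl | rfl | rfl | rfl <;>
    first
    | exact absurd rfl n2
    | exact absurd rfl n3
    | exact absurd h k1
    | exact absurd h k2
    | exact absurd h k3
    | tauto
  rcases keys s hsc hsS ns2 ns3 with hs1 | hs1
  · exact exists_normalForm_of_supports hfin hV he hs h2 h3 htc htS nt2 nt3 hst.symm hs1 hsS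
  rcases keys t htc htS nt2 nt3 with ht1 | ht1
  · exact exists_normalForm_of_supports hfin hV he hs h2 h3 hsc hsS ns2 ns3 hst ht1 htS
  -- The two remaining supports would be `{2, 3, 4}` and the full set, which exclude each other.
  exfalso
  rcases hs1 with rfl | rfl <;> rcases ht1 with rfl | rfl
  · exact hst rfl
  · exact k4 hsS htS
  · exact k4 htS hsS
  · exact hst rfl

end NormalForm

end CubicThreefold

namespace CubicThreefold

open scoped LinearAlgebra.Projectivization

/-! ### Nodes and planes of the normal form -/

section NormalFormGeometry

variable {k V : Type*} [Field k] [AddCommGroup V] [Module k V]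
variable {M : V →ₗ[k] V →ₗ[k] V →ₗ[k] k}

/-- Over an infinite field the derivative of a cubic map is determined by its values. -/
theorem dif_eq_of_cub_eq [Infinite k] {M' : V →ₗ[k] V →ₗ[k] V →ₗ[k] k}
    (h : ∀ v, cub M v = cub M' v) (v w : V) : dif M v w = dif M' v w := by
  classical
  obtain ⟨t, ht⟩ := Infinite.exists_notMem_finset ({0, 1} : Finset k)
  simp only [Finset.mem_insert, Finset.mem_singleton, not_or] at ht
  have key : ∀ t : k, t * dif M v w + t ^ 2 * dif M w v = t * dif M' v w + t ^ 2 * dif M' w v := by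
    intro t
    have h1 := h (v + t • w)
    rw [cub_add, cub_add, dif_smul_right, dif_smul_right, dif_smul, dif_smul, h v, h (t • w)] at h1
    linear_combination h1
  have k1 := key 1
  have kt := key t
  refine mul_left_cancel₀ (mul_ne_zero ht.1 (sub_ne_zero.2 (Ne.symm ht.2))) ?_
  linear_combination kt - t ^ 2 * k1

/-- Over an infinite field a vector space is not the union of three proper subspaces. -/
theorem exists_mem_forall_ne_zero [Infinite k] (W : Submodule k V) (f g h : V →ₗ[k] k)
    (H : ∀ v ∈ W, f v * g v * h v = 0) :
    (∀ v ∈ W, f v = 0) ∨ (∀ v ∈ W, g v = 0) ∨ ∀ v ∈ W, h v = 0 := by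
  by_contra! hcon
  obtain ⟨h1, h2, h3⟩ := hcon
  obtain ⟨v, hv, hne⟩ := Module.Dual.exists_forall_mem_ne_zero_of_forall_exists W ![f, g, h]
    (fun i => by fin_cases i; exacts [h1, h2, h3])
  have := H v hv
  simp only [mul_eq_zero] at this
  rcases this with (h | h) | h
  · exact hne 0 h
  · exact hne 1 h
  · exact hne 2 h

theorem exists_eq_mul_of_forall_eq_zero (W : Submodule k V) (f g : V →ₗ[k] k)
    (H : ∀ v ∈ W, f v = 0 → g v = 0) : ∃ c : k, ∀ v ∈ W, g v = c * f v := by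
  by_cases h0 : ∀ v ∈ W, f v = 0
  · exact ⟨0, fun v hv => by rw [H v hv (h0 v hv), zero_mul]⟩
  · push Not at h0
    obtain ⟨w, hw, hw0⟩ := h0
    refine ⟨g w / f w, fun v hv => ?_⟩
    have := H (v - (f v / f w) • w) (W.sub_mem hv (W.smul_mem _ hw)) (by simp [hw0])
    simp only [map_sub, map_smul, smul_eq_mul, sub_eq_zero] at this
    rw [this]
    ring

theorem finrank_ker_of_surjective (hV : Module.finrank k V = 5) {W : Type*} [AddCommGroup W]
    [Module k W] [FiniteDimensional k W] (f : V →ₗ[k] W) (hf : Function.Surjective f) :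
    Module.finrank k (LinearMap.ker f) = 5 - Module.finrank k W := by
  have hFD : FiniteDimensional k V := FiniteDimensional.of_finrank_eq_succ hV
  have := LinearMap.finrank_range_add_finrank_ker f
  rw [LinearMap.range_eq_top.2 hf, finrank_top, hV] at this
  omega

/-- The trilinear form given by a product of three linear forms. -/
def tri (f g h : V →ₗ[k] k) : V →ₗ[k] V →ₗ[k] V →ₗ[k] k := f.smulRight (g.smulRight h)

theorem tri_apply (f g h : V →ₗ[k] k) (u v w : V) : tri f g h u v w = f u * (g v * h w) := by
  simp [tri]

namespace NormalForm

variable (N : NormalForm M)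
include N

theorem dif_eq [Infinite k] (v w : V) : dif M v w =
    N.α * (N.l 0 w * N.l 1 v * N.l 2 v + N.l 0 v * N.l 1 w * N.l 2 v +
      N.l 0 v * N.l 1 v * N.l 2 w) -
    N.β * (N.m 0 w * N.m 1 v * N.m 2 v + N.m 0 v * N.m 1 w * N.m 2 v +
      N.m 0 v * N.m 1 v * N.m 2 w) := by
  rw [dif_eq_of_cub_eq (M' := tri (N.α • N.l 0) (N.l 1) (N.l 2) +
    tri ((-N.β) • N.m 0) (N.m 1) (N.m 2)) fun v => ?_]
  · simp only [dif, LinearMap.add_apply, tri_apply, LinearMap.smul_apply, smul_eq_mul]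
    ring
  · rw [N.cub_eq]
    simp only [cub, LinearMap.add_apply, tri_apply, LinearMap.smul_apply, smul_eq_mul]
    ring

/-- Five of the six forms already separate vectors, hence are coordinates on the five-dimensional
space; the sum relation fixes the sixth. -/
theorem exists_vec (hV : Module.finrank k V = 5) {x y : Fin 3 → k} (h : ∑ i, x i = ∑ i, y i) :
    ∃ v, (∀ i, N.l i v = x i) ∧ ∀ j, N.m j v = y j := by
  have hFD : FiniteDimensional k V := FiniteDimensional.of_finrank_eq_succ hV
  let f : V →ₗ[k] (Fin 5 → k) := LinearMap.pi ![N.l 0, N.l 1, N.l 2, N.m 0, N.m 1]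
  have hinj : Function.Injective f := by
    rw [← LinearMap.ker_eq_bot, LinearMap.ker_eq_bot']
    intro v hv
    have h0 : N.l 0 v = 0 := congrFun hv 0
    have h1 : N.l 1 v = 0 := congrFun hv 1
    have h2 : N.l 2 v = 0 := congrFun hv 2
    have h3 : N.m 0 v = 0 := congrFun hv 3
    have h4 : N.m 1 v = 0 := congrFun hv 4
    have h5 : N.m 2 v = 0 := by
      have := N.sum_eq v
      rw [h0, h1, h2, h3, h4] at this
      simpa using this.symm
    refine N.sep v (fun i => ?_) (fun i => ?_) <;> fin_cases i <;> assumption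
  obtain ⟨v, hv⟩ := (LinearMap.injective_iff_surjective_of_finrank_eq_finrank
    (by simp [hV])).1 hinj ![x 0, x 1, x 2, y 0, y 1]
  have h0 : N.l 0 v = x 0 := congrFun hv 0
  have h1 : N.l 1 v = x 1 := congrFun hv 1
  have h2 : N.l 2 v = x 2 := congrFun hv 2
  have h3 : N.m 0 v = y 0 := congrFun hv 3
  have h4 : N.m 1 v = y 1 := congrFun hv 4
  have h5 : N.m 2 v = y 2 := by
    have := N.sum_eq v
    rw [h0, h1, h2, h3, h4] at this
    rw [Fin.sum_univ_three, Fin.sum_univ_three] at h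
    linear_combination h - this
  refine ⟨v, fun i => ?_, fun i => ?_⟩ <;> fin_cases i <;> assumption

theorem ext {v w : V} (hl : ∀ i, N.l i v = N.l i w) (hm : ∀ i, N.m i v = N.m i w) : v = w :=
  sub_eq_zero.1 (N.sep _ (fun i => by rw [map_sub, hl, sub_self])
    (fun i => by rw [map_sub, hm, sub_self]))

/-- Four of the linear forms, two of each kind, take arbitrary values. -/
theorem exists_vec_of_four (hV : Module.finrank k V = 5) {a a' b b' : Fin 3} (ha : a ≠ a')
    (hb : b ≠ b') (p p' q q' : k) :
    ∃ v, N.l a v = p ∧ N.l a' v = p' ∧ N.m b v = q ∧ N.m b' v = q' := by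
  obtain ⟨c, hc, hc'⟩ : ∃ c : Fin 3, c ≠ b ∧ c ≠ b' := by
    clear * - hb
    revert b b'
    decide
  obtain ⟨v, hv, hv'⟩ := N.exists_vec hV
    (x := Pi.single a p + Pi.single a' p')
    (y := Pi.single b q + Pi.single b' q' + Pi.single c (p + p' - q - q'))
    -- The third `m`-form is free and absorbs the sum condition.
    (by simp [Finset.sum_add_distrib])
  refine ⟨v, ?_, ?_, ?_, ?_⟩
  · simp [hv, ha]
  · simp [hv, ha.symm]
  · simp [hv', hb, hc.symm]
  · simp [hv', hb.symm, hc'.symm]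

theorem exists_node (hV : Module.finrank k V = 5) (p : Fin 3 × Fin 3) :
    ∃ v, (∀ i, N.l i v = if i = p.1 then 1 else 0) ∧ ∀ j, N.m j v = if j = p.2 then 1 else 0 :=
  N.exists_vec hV (by simp)

/-- The node at which only `l p.1` and `m p.2` do not vanish. -/
noncomputable def node (hV : Module.finrank k V = 5) (p : Fin 3 × Fin 3) : V :=
  (N.exists_node hV p).choose

theorem l_node (hV : Module.finrank k V = 5) (p : Fin 3 × Fin 3) (i : Fin 3) :
    N.l i (N.node hV p) = if i = p.1 then 1 else 0 :=
  (N.exists_node hV p).choose_spec.1 i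

theorem m_node (hV : Module.finrank k V = 5) (p : Fin 3 × Fin 3) (i : Fin 3) :
    N.m i (N.node hV p) = if i = p.2 then 1 else 0 :=
  (N.exists_node hV p).choose_spec.2 i

theorem node_ne_zero (hV : Module.finrank k V = 5) (p : Fin 3 × Fin 3) : N.node hV p ≠ 0 :=
  fun h => by simpa [h] using N.l_node hV p p.1

/-- Two factors of each product vanish at a node, so both products vanish there to second order. -/
theorem isSing_node [Infinite k] (hV : Module.finrank k V = 5) (p : Fin 3 × Fin 3) :
    IsSing M (N.node hV p) := by
  obtain ⟨i, j⟩ := p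
  refine ⟨?_, fun w => ?_⟩
  · rw [N.cub_eq]
    simp only [l_node, m_node]
    fin_cases i <;> fin_cases j <;> simp
  · rw [N.dif_eq]
    simp only [l_node, m_node]
    fin_cases i <;> fin_cases j <;> simp

/-- The projective point of a node. -/
noncomputable def nodePt [Infinite k] (hV : Module.finrank k V = 5) (p : Fin 3 × Fin 3) :
    singPts M :=
  ⟨Projectivization.mk k _ (N.node_ne_zero hV p),
    (mk_mem_singPts _).2 (N.isSing_node hV p)⟩

theorem nodePt_injective [Infinite k] (hV : Module.finrank k V = 5) :
    Function.Injective (N.nodePt hV) := by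
  intro p q h
  have h1 := Subtype.ext_iff.1 h
  simp only [nodePt] at h1
  rw [Projectivization.mk_eq_mk_iff'] at h1
  obtain ⟨c, hc⟩ := h1
  have h2 := N.l_node hV p p.1
  have h3 := N.m_node hV p p.2
  rw [← hc] at h2 h3
  simp only [map_smul, l_node, m_node, smul_eq_mul] at h2 h3
  refine Prod.ext ?_ ?_
  · by_contra hne
    simp [hne] at h2
  · by_contra hne
    simp [hne] at h3

theorem nodePt_bijective [Infinite k] (hV : Module.finrank k V = 5)
    (hM : (singPts M).ncard = 9) : Function.Bijective (N.nodePt hV) := by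
  have hfin : (singPts M).Finite := Set.finite_of_ncard_ne_zero (by omega)
  have := hfin.fintype
  rw [Fintype.bijective_iff_injective_and_card]
  refine ⟨N.nodePt_injective hV, ?_⟩
  rw [← Nat.card_eq_fintype_card (α := singPts M), Nat.card_coe_set_eq, hM]
  simp

theorem exists_smul_node [Infinite k] (hV : Module.finrank k V = 5)
    (hM : (singPts M).ncard = 9) {v : V} (hv : v ≠ 0) (hs : IsSing M v) :
    ∃ p, ∃ c : k, c ≠ 0 ∧ v = c • N.node hV p := by
  obtain ⟨p, hp⟩ := (N.nodePt_bijective hV hM).2 ⟨_, (mk_mem_singPts hv).2 hs⟩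
  have h1 := Subtype.ext_iff.1 hp
  simp only [nodePt] at h1
  rw [Eq.comm, Projectivization.mk_eq_mk_iff'] at h1
  obtain ⟨c, hc⟩ := h1
  refine ⟨p, c, ?_, hc.symm⟩
  rintro rfl
  exact hv (by simpa using hc.symm)

/-- Otherwise the point at which all six forms agree is a tenth singular point. -/
theorem α_ne_β [Infinite k] (hV : Module.finrank k V = 5) (hM : (singPts M).ncard = 9) :
    N.α ≠ N.β := by
  intro h
  obtain ⟨v, hv, hv'⟩ := N.exists_vec hV (x := fun _ => 1) (y := fun _ => 1) rfl
  have hs : IsSing M v := by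
    refine ⟨?_, fun w => ?_⟩
    · rw [N.cub_eq]
      simp [hv, hv', h]
    · rw [N.dif_eq]
      simp only [hv, hv', h]
      linear_combination N.β * N.sum_eq w
  have hv0 : v ≠ 0 := fun h0 => by simpa [h0] using hv 0
  obtain ⟨p, c, -, hc⟩ := N.exists_smul_node hV hM hv0 hs
  obtain ⟨i, hi⟩ := exists_ne p.1
  have := hv i
  rw [hc] at this
  simp [l_node, hi] at this

/-- The nodes are ordinary: the polarization at a node is nondegenerate. -/
theorem eq_smul_node_of_pol_eq_zero [Infinite k] (hV : Module.finrank k V = 5)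
    (p : Fin 3 × Fin 3) {w : V} (h : ∀ u, pol M (N.node hV p) u w = 0) :
    ∃ c : k, w = c • N.node hV p := by
  obtain ⟨i, j⟩ := p
  have hpol : ∀ v u w, pol M v u w = dif M (v + u) w - dif M v w - dif M u w := fun v u w => by
    rw [dif_add]; ring
  have key : ∀ i', i' ≠ i → ∀ j', j' ≠ j → N.l i' w = 0 ∧ N.m j' w = 0 := by
    intro i' hi j' hj
    obtain ⟨i'', hi'', hii⟩ : ∃ c : Fin 3, c ≠ i ∧ c ≠ i' := by
      clear * - hi
      revert i i'
      decide
    obtain ⟨j'', hj'', hjj⟩ : ∃ c : Fin 3, c ≠ j ∧ c ≠ j' := by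
      clear * - hj
      revert j j'
      decide
    -- The vector `u` shares the nonzero `m`-form of the node but not its `l`-form, so the second
    -- product contributes nothing and the polarization is `α * l i' w`. The vector `u2` isolates `m
    -- j' w` in the same way.
    obtain ⟨u, hu, hu'⟩ := N.exists_vec hV (x := Pi.single i'' 1) (y := Pi.single j 1) (by simp)
    obtain ⟨u2, hu2, hu2'⟩ := N.exists_vec hV (x := Pi.single i 1) (y := Pi.single j'' 1) (by simp)
    have h1 := h u
    have h2 := h u2
    rw [hpol, N.dif_eq, N.dif_eq, N.dif_eq] at h1 h2
    simp only [map_add, l_node, m_node, hu, hu'] at h1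
    simp only [map_add, l_node, m_node, hu2, hu2'] at h2
    have hα := N.hα
    have hβ := N.hβ
    constructor
    · fin_cases i <;> fin_cases i' <;> fin_cases i'' <;> simp at hi hi'' hii <;>
        fin_cases j <;> simpa [hα] using h1
    · fin_cases j <;> fin_cases j' <;> fin_cases j'' <;> simp at hj hj'' hjj <;>
        fin_cases i <;> simpa [hβ] using h2
  have hl : ∀ i', i' ≠ i → N.l i' w = 0 := fun i' hi => by
    obtain ⟨j', hj⟩ := exists_ne j
    exact (key i' hi j' hj).1
  have hm : ∀ j', j' ≠ j → N.m j' w = 0 := fun j' hj => by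
    obtain ⟨i', hi⟩ := exists_ne i
    exact (key i' hi j' hj).2
  have hij : N.l i w = N.m j w := by
    have h1 : ∑ i, N.l i w = N.l i w := Finset.sum_eq_single i (fun i' _ hi => hl i' hi) (by simp)
    have h2 : ∑ j, N.m j w = N.m j w := Finset.sum_eq_single j (fun j' _ hj => hm j' hj) (by simp)
    rw [← h1, ← h2, Fin.sum_univ_three, Fin.sum_univ_three, N.sum_eq]
  refine ⟨N.l i w, N.ext (fun i' => ?_) (fun j' => ?_)⟩
  · rw [map_smul, l_node]
    by_cases hi : i' = i
    · simp [hi]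
    · simp [hi, hl i' hi]
  · rw [map_smul, m_node]
    by_cases hj : j' = j
    · simp [hj, hij]
    · simp [hj, hm j' hj]

/-- The plane `l p.1 = m p.2 = 0`. -/
def plane (p : Fin 3 × Fin 3) : Submodule k V :=
  LinearMap.ker (N.l p.1) ⊓ LinearMap.ker (N.m p.2)

theorem mem_plane {p : Fin 3 × Fin 3} {v : V} :
    v ∈ N.plane p ↔ N.l p.1 v = 0 ∧ N.m p.2 v = 0 := by
  simp [plane]

theorem node_mem_plane (hV : Module.finrank k V = 5) (p q : Fin 3 × Fin 3) :
    N.node hV p ∈ N.plane q ↔ p.1 ≠ q.1 ∧ p.2 ≠ q.2 := by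
  simp [mem_plane, l_node, m_node, eq_comm]

/-- A plane is recovered from the nodes lying on it. -/
theorem plane_injective (hV : Module.finrank k V = 5) : Function.Injective N.plane := by
  intro p q h
  have key : ∀ r : Fin 3 × Fin 3, (r.1 ≠ p.1 ∧ r.2 ≠ p.2) ↔ (r.1 ≠ q.1 ∧ r.2 ≠ q.2) := fun r => by
    rw [← N.node_mem_plane hV, ← N.node_mem_plane hV, h]
  clear * - key
  revert p q
  decide

theorem finrank_plane (hV : Module.finrank k V = 5) (p : Fin 3 × Fin 3) :
    Module.finrank k (N.plane p) = 3 := by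
  obtain ⟨a, ha⟩ := exists_ne p.1
  obtain ⟨b, hb⟩ := exists_ne p.2
  have h := finrank_ker_of_surjective hV ((N.l p.1).prod (N.m p.2)) (by
    rintro ⟨x, y⟩
    obtain ⟨v, h1, -, h2, -⟩ := N.exists_vec_of_four hV ha.symm hb.symm x 0 y 0
    exact ⟨v, Prod.ext h1 h2⟩)
  rw [LinearMap.ker_prod] at h
  exact h.trans (by simp)

theorem cub_of_mem_plane {p : Fin 3 × Fin 3} {v : V} (h : v ∈ N.plane p) : cub M v = 0 := by
  obtain ⟨i, j⟩ := p
  obtain ⟨h1, h2⟩ := N.mem_plane.1 h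
  rw [N.cub_eq]
  fin_cases i <;> fin_cases j <;> simp_all

/-- Two distinct planes meet in a line if they are in the same row or column. -/
theorem finrank_plane_inf (hV : Module.finrank k V = 5) (p q : Fin 3 × Fin 3) :
    Module.finrank k (N.plane p ⊓ N.plane q : Submodule k V) = 2 ↔
      (p.1 ≠ q.1 ∧ p.2 = q.2) ∨ (p.2 ≠ q.2 ∧ p.1 = q.1) := by
  obtain ⟨a, b⟩ := p
  obtain ⟨a', b'⟩ := q
  by_cases ha : a = a' <;> by_cases hb : b = b'
  · subst ha hb
    have := N.finrank_plane hV (a, b)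
    rw [inf_idem, this]
    simp
  · subst ha
    obtain ⟨c, hc⟩ := exists_ne a
    have h := finrank_ker_of_surjective hV ((N.l a).prod ((N.m b).prod (N.m b'))) (by
      rintro ⟨x, y, z⟩
      obtain ⟨v, h1, -, h2, h3⟩ := N.exists_vec_of_four hV hc.symm hb x 0 y z
      exact ⟨v, Prod.ext h1 (Prod.ext h2 h3)⟩)
    have hk : LinearMap.ker ((N.l a).prod ((N.m b).prod (N.m b'))) =
        N.plane (a, b) ⊓ N.plane (a, b') := by
      ext v
      simp [mem_plane]
      tauto
    rw [hk] at h
    simp [h, hb]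
  · subst hb
    obtain ⟨c, hc⟩ := exists_ne b
    have h := finrank_ker_of_surjective hV ((N.l a).prod ((N.l a').prod (N.m b))) (by
      rintro ⟨x, y, z⟩
      obtain ⟨v, h1, h2, h3, -⟩ := N.exists_vec_of_four hV ha hc.symm x y z 0
      exact ⟨v, Prod.ext h1 (Prod.ext h2 h3)⟩)
    have hk : LinearMap.ker ((N.l a).prod ((N.l a').prod (N.m b))) =
        N.plane (a, b) ⊓ N.plane (a', b) := by
      ext v
      simp [mem_plane]
      tauto
    rw [hk] at h
    simp [h, ha]
  · have h := finrank_ker_of_surjective hV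
      (((N.l a).prod (N.m b)).prod ((N.l a').prod (N.m b'))) (by
      rintro ⟨⟨x, y⟩, z, t⟩
      obtain ⟨v, h1, h2, h3, h4⟩ := N.exists_vec_of_four hV ha hb x z y t
      exact ⟨v, Prod.ext (Prod.ext h1 h3) (Prod.ext h2 h4)⟩)
    have hk : LinearMap.ker (((N.l a).prod (N.m b)).prod ((N.l a').prod (N.m b'))) =
        N.plane (a, b) ⊓ N.plane (a', b') := by
      ext v
      simp [mem_plane]
    rw [hk] at h
    simp [h, ha, hb]

/-- Every plane in the cubic is one of the nine. -/
theorem exists_eq_plane [Infinite k] (hV : Module.finrank k V = 5) (hαβ : N.α ≠ N.β)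
    {W : Submodule k V} (hW : Module.finrank k W = 3) (h : ∀ v ∈ W, cub M v = 0) :
    ∃ p, W = N.plane p := by
  have hFD : FiniteDimensional k V := FiniteDimensional.of_finrank_eq_succ hV
  have hα := N.hα
  have hβ := N.hβ
  have hprod : ∀ v ∈ W, N.α * (N.l 0 v * N.l 1 v * N.l 2 v) =
      N.β * (N.m 0 v * N.m 1 v * N.m 2 v) := fun v hv => by
    have := h v hv
    rw [N.cub_eq] at this
    exact sub_eq_zero.1 this
  have hlz : ∀ a v, N.l a v = 0 → N.l 0 v * N.l 1 v * N.l 2 v = 0 := fun a v hv => by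
    fin_cases a <;> simp_all
  have hmz : ∀ a v, N.m a v = 0 → N.m 0 v * N.m 1 v * N.m 2 v = 0 := fun a v hv => by
    fin_cases a <;> simp_all
  -- Where one `l` vanishes on a subspace of `W`, so does the product of the `m`, and therefore one
  -- of the `m`.
  have hl0 : ∀ (a : Fin 3) (W' : Submodule k V), W' ≤ W → (∀ v ∈ W', N.l a v = 0) →
      ∃ b, ∀ v ∈ W', N.m b v = 0 := by
    intro a W' hW' h0
    have := exists_mem_forall_ne_zero W' (N.m 0) (N.m 1) (N.m 2) fun v hv => by
      have h1 := hprod v (hW' hv)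
      rw [hlz a v (h0 v hv), mul_zero] at h1
      exact (mul_eq_zero.1 h1.symm).resolve_left hβ
    rcases this with h | h | h
    exacts [⟨0, h⟩, ⟨1, h⟩, ⟨2, h⟩]
  have hm0 : ∀ (b : Fin 3) (W' : Submodule k V), W' ≤ W → (∀ v ∈ W', N.m b v = 0) →
      ∃ a, ∀ v ∈ W', N.l a v = 0 := by
    intro b W' hW' h0
    have := exists_mem_forall_ne_zero W' (N.l 0) (N.l 1) (N.l 2) fun v hv => by
      have h1 := hprod v (hW' hv)
      rw [hmz b v (h0 v hv), mul_zero] at h1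
      exact (mul_eq_zero.1 h1).resolve_left hα
    rcases this with h | h | h
    exacts [⟨0, h⟩, ⟨1, h⟩, ⟨2, h⟩]
  have hdone : ∀ a b, (∀ v ∈ W, N.l a v = 0) → (∀ v ∈ W, N.m b v = 0) → ∃ p, W = N.plane p :=
    fun a b h1 h2 => ⟨(a, b), Submodule.eq_of_le_of_finrank_eq
      (fun v hv => N.mem_plane.2 ⟨h1 v hv, h2 v hv⟩) (by rw [hW, N.finrank_plane hV])⟩
  by_cases hl : ∃ a, ∀ v ∈ W, N.l a v = 0
  · obtain ⟨a, ha⟩ := hl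
    obtain ⟨b, hb⟩ := hl0 a W le_rfl ha
    exact hdone a b ha hb
  by_cases hm : ∃ b, ∀ v ∈ W, N.m b v = 0
  · obtain ⟨b, hb⟩ := hm
    obtain ⟨a, ha⟩ := hm0 b W le_rfl hb
    exact hdone a b ha hb
  exfalso
  -- If no form vanishes on `W`, the same argument on the kernels shows that each `l` is matched
  -- with a proportional `m` and conversely. The three `l` are then coordinates on `W`, the matching
  -- is a bijection, the sum relation makes all factors 1, and comparing products gives `α = β`.
  have hlm : ∀ a, ∃ b, ∃ c : k, ∀ v ∈ W, N.m b v = c * N.l a v := fun a => by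
    obtain ⟨b, hb⟩ := hl0 a (W ⊓ LinearMap.ker (N.l a)) inf_le_left fun v hv => by
      simpa using hv.2
    exact ⟨b, exists_eq_mul_of_forall_eq_zero W _ _ fun v hv h0 => hb v ⟨hv, by simpa using h0⟩⟩
  have hml : ∀ b, ∃ a, ∃ c : k, ∀ v ∈ W, N.m b v = c * N.l a v := fun b => by
    obtain ⟨a, ha⟩ := hm0 b (W ⊓ LinearMap.ker (N.m b)) inf_le_left fun v hv => by
      simpa using hv.2
    obtain ⟨c, hc⟩ := exists_eq_mul_of_forall_eq_zero W (N.m b) (N.l a)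
      fun v hv h0 => ha v ⟨hv, by simpa using h0⟩
    have hc0 : c ≠ 0 := by
      rintro rfl
      exact hl ⟨a, fun v hv => by rw [hc v hv, zero_mul]⟩
    exact ⟨a, c⁻¹, fun v hv => by rw [hc v hv, inv_mul_cancel_left₀ hc0]⟩
  let f : W →ₗ[k] (Fin 3 → k) := (LinearMap.pi N.l).comp W.subtype
  have hinj : Function.Injective f := by
    rw [← LinearMap.ker_eq_bot, LinearMap.ker_eq_bot']
    intro v hv
    have h1 : ∀ i, N.l i v = 0 := fun i => congrFun hv i
    refine Subtype.ext (N.sep v h1 fun b => ?_)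
    obtain ⟨a, c, hc⟩ := hml b
    rw [hc v v.2, h1, mul_zero]
  have hsurj : ∀ x : Fin 3 → k, ∃ v ∈ W, ∀ i, N.l i v = x i := fun x => by
    obtain ⟨v, hv⟩ := (LinearMap.injective_iff_surjective_of_finrank_eq_finrank
      (by simp [hW])).1 hinj x
    exact ⟨v, v.2, fun i => congrFun hv i⟩
  choose b c hbc using hlm
  have hb : Function.Injective b := by
    intro i j hij
    by_contra hne
    obtain ⟨v, hv, hvx⟩ := hsurj (Pi.single i 1)
    have h1 := hbc i v hv
    rw [hij, hbc j v hv, hvx, hvx] at h1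
    simp [Ne.symm hne] at h1
    exact hm ⟨b i, fun w hw => by rw [hbc i w hw, ← h1, zero_mul]⟩
  have hsum : ∀ v ∈ W, ∑ i, N.l i v = ∑ i, c i * N.l i v := fun v hv => by
    have h1 : ∑ i, N.m (b i) v = ∑ i, N.m i v :=
      Equiv.sum_comp (Equiv.ofBijective b (Finite.injective_iff_bijective.1 hb)) fun i => N.m i v
    rw [← Finset.sum_congr rfl fun i _ => hbc i v hv, h1, Fin.sum_univ_three, Fin.sum_univ_three,
      N.sum_eq]
  have hc : ∀ i, c i = 1 := fun i => by
    obtain ⟨v, hv, hvx⟩ := hsurj (Pi.single i 1)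
    have := hsum v hv
    simp only [hvx] at this
    simpa [Pi.single_apply] using this.symm
  obtain ⟨v, hv, hvx⟩ := hsurj fun _ => 1
  have h1 : ∏ i, N.m (b i) v = ∏ i, N.m i v :=
    Equiv.prod_comp (Equiv.ofBijective b (Finite.injective_iff_bijective.1 hb)) fun i => N.m i v
  simp only [hbc _ v hv, hc, hvx, mul_one, Finset.prod_const_one] at h1
  have h2 := hprod v hv
  rw [Fin.prod_univ_three] at h1
  rw [← h1] at h2
  simp only [hvx, mul_one] at h2
  exact hαβ h2

end NormalForm

end NormalFormGeometry

end CubicThreefold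

namespace CubicThreefold

/-! ### The automorphism group of the grid and the wreath product -/

section GridGroup

/-- The cells of a `3 × 3` grid; they index both the nodes and the planes. -/
abbrev Grid : Type := Fin 3 × Fin 3

/-- Incidence of the node indexed by `p` with the plane indexed by `q`. -/
def Incident (p q : Grid) : Prop := p.1 ≠ q.1 ∧ p.2 ≠ q.2

instance (p q : Grid) : Decidable (Incident p q) := inferInstanceAs (Decidable (_ ∧ _))

/-- The automorphism group of the incidence structure on the grid. -/
def gridGroup : Subgroup (Equiv.Perm Grid × Equiv.Perm Grid) where
  carrier := {g | ∀ p q, Incident (g.1 p) (g.2 q) ↔ Incident p q}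
  one_mem' := fun _ _ => Iff.rfl
  mul_mem' := fun {a b} ha hb p q => (ha (b.1 p) (b.2 q)).trans (hb p q)
  inv_mem' := fun {a} ha p q => by
    have h := ha (a.1⁻¹ p) (a.2⁻¹ q)
    simp only [Equiv.Perm.inv_def, Equiv.apply_symm_apply] at h
    exact h.symm

/-- The permutation of the grid given by permutations of the rows and of the columns, followed by
the transposition if `ε` is true. -/
def gridPerm (ε : Bool) (s t : Equiv.Perm (Fin 3)) : Equiv.Perm Grid :=
  (if ε then Equiv.prodComm _ _ else 1) * Equiv.prodCongr s t

theorem gridPerm_false (s t : Equiv.Perm (Fin 3)) (p : Grid) :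
    gridPerm false s t p = (s p.1, t p.2) := rfl

theorem gridPerm_true (s t : Equiv.Perm (Fin 3)) (p : Grid) :
    gridPerm true s t p = (t p.2, s p.1) := rfl

theorem gridPerm_mem (ε : Bool) (s t : Equiv.Perm (Fin 3)) :
    (gridPerm ε s t, gridPerm ε s t) ∈ gridGroup := by
  intro p q
  cases ε
  · simp [gridPerm_false, Incident]
  · simp [gridPerm_true, Incident, and_comm]

/-- Two distinct cells in a common row or column. -/
def Aligned (p q : Grid) : Prop := p ≠ q ∧ (p.1 = q.1 ∨ p.2 = q.2)

instance (p q : Grid) : Decidable (Aligned p q) := inferInstanceAs (Decidable (_ ∧ _))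

/-- Alignment is expressed through incidence, so that every automorphism preserves it. -/
theorem card_incident_eq_two_iff (p p' : Grid) :
    (Finset.univ.filter fun q => Incident p q ∧ Incident p' q).card = 2 ↔ Aligned p p' := by
  revert p p'
  decide

theorem aligned_apply_iff {g : Equiv.Perm Grid × Equiv.Perm Grid} (hg : g ∈ gridGroup)
    (p p' : Grid) : Aligned (g.1 p) (g.1 p') ↔ Aligned p p' := by
  rw [← card_incident_eq_two_iff, ← card_incident_eq_two_iff p]
  have : (Finset.univ.filter fun q => Incident (g.1 p) q ∧ Incident (g.1 p') q) =
      (Finset.univ.filter fun q => Incident p q ∧ Incident p' q).map g.2.toEmbedding := by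
    ext q
    have h1 := hg p (g.2.symm q)
    have h2 := hg p' (g.2.symm q)
    rw [Equiv.apply_symm_apply] at h1 h2
    simp [Finset.mem_map_equiv, h1, h2]
  rw [this, Finset.card_map]

theorem aligned_dichotomy (x y z : Grid) (hy : Aligned x y) (hz : Aligned x z) (hyz : y ≠ z)
    (h : ¬ Aligned y z) : x.1 = y.1 ↔ ¬ x.1 = z.1 := by
  have key : ∀ a b c a' b' c' : Fin 3, Aligned (a, a') (b, b') → Aligned (a, a') (c, c') →
      (b, b') ≠ (c, c') → ¬ Aligned (b, b') (c, c') → (a = b ↔ ¬ a = c) := by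
    simp only [Aligned, ne_eq, Prod.mk.injEq]
    intro a b c a' b' c'
    by_cases h1 : a = b <;> by_cases h2 : a = c <;> simp_all
  exact key _ _ _ _ _ _ hy hz hyz h

/-- By `aligned_dichotomy`, a row neighbour and a column neighbour of a cell have images of opposite
kinds. One pair kept in a row therefore decides the matter for all pairs, and `f` acts on rows and
columns separately. -/
theorem exists_eq_gridPerm_of_row (f : Equiv.Perm Grid)
    (hf : ∀ p p', Aligned (f p) (f p') ↔ Aligned p p') (h0 : (f (0, 0)).1 = (f (0, 1)).1) :
    ∃ s t, f = gridPerm false s t := by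
  have H : ∀ i j i' j' : Fin 3, i ≠ i' → j ≠ j' →
      ((f (i, j)).1 = (f (i, j')).1 ↔ ¬ (f (i, j)).1 = (f (i', j)).1) := by
    intro i j i' j' hi hj
    refine aligned_dichotomy _ _ _ ((hf _ _).2 ?_) ((hf _ _).2 ?_) (f.injective.ne ?_)
      ((hf _ _).not.2 ?_)
    · simp [Aligned, hj]
    · simp [Aligned, hi]
    · simp [hi]
    · simp [Aligned, hi, hj.symm]
  have hstart : ∀ j, (f (0, 0)).1 = (f (0, j)).1 := by
    intro j
    by_cases hj : j = 0
    · rw [hj]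
    · exact (H 0 0 1 j (by decide) (Ne.symm hj)).2 ((H 0 0 1 1 (by decide) (by decide)).1 h0)
  have hrow0 : ∀ j j', (f (0, j)).1 = (f (0, j')).1 := fun j j' => by
    rw [← hstart j, ← hstart j']
  have hrow : ∀ i j j', (f (i, j)).1 = (f (i, j')).1 := by
    intro i j j'
    by_cases hi : i = 0
    · rw [hi]; exact hrow0 j j'
    · by_cases hj : j = j'
      · rw [hj]
      · refine (H i j 0 j' hi hj).2 fun h => ?_
        exact (H 0 j i j' (Ne.symm hi) hj).1 (hrow0 j j') h.symm
  have hcol : ∀ i i' j, (f (i, j)).2 = (f (i', j)).2 := by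
    intro i i' j
    by_cases hi : i = i'
    · rw [hi]
    · obtain ⟨j', hj⟩ := exists_ne j
      have h1 := (H i j i' j' hi hj.symm).1 (hrow i j j')
      have h2 : Aligned (f (i, j)) (f (i', j)) := (hf _ _).2 (by simp [Aligned, hi])
      exact h2.2.resolve_left h1
  have hval : ∀ i j, f (i, j) = ((f (i, 0)).1, (f (0, j)).2) := fun i j =>
    Prod.ext (hrow i j 0) (hcol i 0 j)
  have hs : Function.Injective fun i => (f (i, 0)).1 := fun i i' h => by
    have h1 : f (i, 0) = f (i', 0) := Prod.ext h (hcol i i' 0)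
    exact congrArg Prod.fst (f.injective h1)
  have ht : Function.Injective fun j => (f (0, j)).2 := fun j j' h => by
    have h1 : f (0, j) = f (0, j') := Prod.ext (hrow 0 j j') h
    exact congrArg Prod.snd (f.injective h1)
  exact ⟨Equiv.ofBijective _ (Finite.injective_iff_bijective.1 hs),
    Equiv.ofBijective _ (Finite.injective_iff_bijective.1 ht), Equiv.ext fun p => hval p.1 p.2⟩

theorem exists_eq_gridPerm {g : Equiv.Perm Grid × Equiv.Perm Grid} (hg : g ∈ gridGroup) :
    ∃ ε s t, g = (gridPerm ε s t, gridPerm ε s t) := by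
  obtain ⟨ε, s, t, h1⟩ : ∃ ε s t, g.1 = gridPerm ε s t := by
    by_cases h0 : (g.1 (0, 0)).1 = (g.1 (0, 1)).1
    · obtain ⟨s, t, h⟩ := exists_eq_gridPerm_of_row g.1 (aligned_apply_iff hg) h0
      exact ⟨false, s, t, h⟩
    · have h2 : Aligned (g.1 (0, 0)) (g.1 (0, 1)) := (aligned_apply_iff hg _ _).2 (by decide)
      obtain ⟨s, t, h⟩ := exists_eq_gridPerm_of_row (Equiv.prodComm _ _ * g.1) (fun p p' => by
        rw [← aligned_apply_iff hg p p']
        simp only [Aligned, Equiv.Perm.mul_apply, Equiv.prodComm_apply, Prod.fst_swap,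
          Prod.snd_swap, ne_eq, Prod.swap_inj, or_comm]) (h2.2.resolve_left h0)
      refine ⟨true, s, t, Equiv.ext fun p => ?_⟩
      have := DFunLike.congr_fun h p
      rw [gridPerm_false] at this
      rw [gridPerm_true, ← Prod.swap_inj]
      exact this
  refine ⟨ε, s, t, Prod.ext h1 (Equiv.ext fun q => ?_)⟩
  -- A cell is determined by the cells incident to it, so the first component of an automorphism
  -- determines the second.
  have h2 : ∀ p, Incident p (g.2 q) ↔ Incident p (gridPerm ε s t q) := fun p => by
    have h3 := hg (g.1.symm p) q
    have h4 := gridPerm_mem ε s t (g.1.symm p) q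
    simp only [← h1, Equiv.apply_symm_apply] at h3 h4
    rw [h3, ← h4, h1]
  generalize g.2 q = x at h2
  change x = gridPerm ε s t q
  generalize gridPerm ε s t q = y at h2
  clear * - h2
  revert x y
  decide

theorem gridPerm_injective : Function.Injective
    fun x : Bool × Equiv.Perm (Fin 3) × Equiv.Perm (Fin 3) => gridPerm x.1 x.2.1 x.2.2 := by
  have hne : ∀ s t s' t', gridPerm false s t ≠ gridPerm true s' t' := fun s t s' t' h => by
    have h0 := DFunLike.congr_fun h (0, 0)
    have h1 := DFunLike.congr_fun h (0, 1)
    simp only [gridPerm_false, gridPerm_true, Prod.mk.injEq] at h0 h1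
    have := t'.injective (h0.1.symm.trans h1.1)
    exact absurd this (by decide)
  have hst : ∀ s t s' t' : Equiv.Perm (Fin 3), (∀ p : Grid, (s p.1, t p.2) = (s' p.1, t' p.2)) →
      s = s' ∧ t = t' := fun s t s' t' h =>
    ⟨Equiv.ext fun i => congrArg Prod.fst (h (i, 0)),
      Equiv.ext fun i => congrArg Prod.snd (h (0, i))⟩
  rintro ⟨ε, s, t⟩ ⟨ε', s', t'⟩ h
  cases ε <;> cases ε'
  · obtain ⟨rfl, rfl⟩ := hst s t s' t' fun p => DFunLike.congr_fun h p
    rfl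
  · exact absurd h (hne _ _ _ _)
  · exact absurd h.symm (hne _ _ _ _)
  · obtain ⟨rfl, rfl⟩ := hst s t s' t' fun p =>
      Prod.swap_injective (DFunLike.congr_fun h p)
    rfl

theorem card_gridGroup : Nat.card gridGroup = 72 := by
  let f : Bool × Equiv.Perm (Fin 3) × Equiv.Perm (Fin 3) → gridGroup :=
    fun x => ⟨_, gridPerm_mem x.1 x.2.1 x.2.2⟩
  have hf : Function.Bijective f := by
    refine ⟨fun x y h => gridPerm_injective (congrArg (fun g => g.1.1) h), fun g => ?_⟩
    obtain ⟨ε, s, t, h⟩ := exists_eq_gridPerm g.2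
    exact ⟨(ε, s, t), Subtype.ext h.symm⟩
  rw [← Nat.card_congr (Equiv.ofBijective f hf)]
  simp [Fintype.card_perm, Nat.factorial]

/-- The action of a permutation of six letters on the grid, the cell `(i, j)` being viewed as the
pair `{inl i, inr j}`; it is meaningful for permutations preserving the two triples. -/
def cellMap (σ : Equiv.Perm (Fin 3 ⊕ Fin 3)) (p : Grid) : Grid :=
  match σ (Sum.inl p.1), σ (Sum.inr p.2) with
  | Sum.inl a, Sum.inr b => (a, b)
  | Sum.inr b, Sum.inl a => (a, b)
  | _, _ => p

/-- Moving the switch past a pair of permutations exchanges them, so the elements of these two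
shapes are closed under products and inverses. -/
theorem exists_eq_of_mem_Gam {σ : Equiv.Perm (Fin 3 ⊕ Fin 3)} (hσ : σ ∈ Gam) :
    ∃ s t, σ = Equiv.Perm.sumCongr s t ∨
      σ = Equiv.sumComm (Fin 3) (Fin 3) * Equiv.Perm.sumCongr s t := by
  have hc : ∀ s t : Equiv.Perm (Fin 3), Equiv.Perm.sumCongr s t * Equiv.sumComm (Fin 3) (Fin 3) =
      Equiv.sumComm (Fin 3) (Fin 3) * Equiv.Perm.sumCongr t s := fun s t => by
    ext x
    rcases x with x | x <;> rfl
  have hc2 : (Equiv.sumComm (Fin 3) (Fin 3) : Equiv.Perm (Fin 3 ⊕ Fin 3)) *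
      Equiv.sumComm (Fin 3) (Fin 3) = 1 := by
    ext x
    rcases x with x | x <;> rfl
  induction hσ using Subgroup.closure_induction with
  | mem x hx =>
    rcases hx with ⟨⟨s, t⟩, rfl⟩ | rfl
    · exact ⟨s, t, Or.inl rfl⟩
    · exact ⟨1, 1, Or.inr (by rw [Equiv.Perm.sumCongr_one, mul_one])⟩
  | one => exact ⟨1, 1, Or.inl Equiv.Perm.sumCongr_one.symm⟩
  | mul x y _ _ hx hy =>
    obtain ⟨s, t, rfl | rfl⟩ := hx <;> obtain ⟨s', t', rfl | rfl⟩ := hy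
    · exact ⟨s * s', t * t', Or.inl (Equiv.Perm.sumCongr_mul _ _ _ _)⟩
    · refine ⟨t * s', s * t', Or.inr ?_⟩
      rw [← mul_assoc, hc, mul_assoc, Equiv.Perm.sumCongr_mul]
    · refine ⟨s * s', t * t', Or.inr ?_⟩
      rw [mul_assoc, Equiv.Perm.sumCongr_mul]
    · refine ⟨t * s', s * t', Or.inl ?_⟩
      rw [mul_assoc, ← mul_assoc (Equiv.Perm.sumCongr s t), hc, mul_assoc, ← mul_assoc, hc2,
        one_mul, Equiv.Perm.sumCongr_mul]
  | inv x _ hx =>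
    obtain ⟨s, t, rfl | rfl⟩ := hx
    · exact ⟨s⁻¹, t⁻¹, Or.inl (Equiv.Perm.sumCongr_inv _ _)⟩
    · refine ⟨t⁻¹, s⁻¹, Or.inr ?_⟩
      rw [mul_inv_rev, Equiv.Perm.sumCongr_inv, inv_eq_of_mul_eq_one_right hc2, hc]

theorem cellMap_sumCongr (s t : Equiv.Perm (Fin 3)) :
    cellMap (Equiv.Perm.sumCongr s t) = gridPerm false s t := rfl

theorem cellMap_sumComm_mul (s t : Equiv.Perm (Fin 3)) :
    cellMap (Equiv.sumComm (Fin 3) (Fin 3) * Equiv.Perm.sumCongr s t) = gridPerm true s t := rfl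

theorem sumCongr_mem_Gam (s t : Equiv.Perm (Fin 3)) : Equiv.Perm.sumCongr s t ∈ Gam :=
  Subgroup.subset_closure (Or.inl ⟨(s, t), rfl⟩)

theorem sumComm_mem_Gam : (Equiv.sumComm (Fin 3) (Fin 3) : Equiv.Perm (Fin 3 ⊕ Fin 3)) ∈ Gam :=
  Subgroup.subset_closure (Or.inr rfl)

theorem cellMap_mul {σ τ : Equiv.Perm (Fin 3 ⊕ Fin 3)} (hσ : σ ∈ Gam) (hτ : τ ∈ Gam) :
    cellMap (σ * τ) = cellMap σ ∘ cellMap τ := by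
  obtain ⟨s, t, rfl | rfl⟩ := exists_eq_of_mem_Gam hσ <;>
    obtain ⟨s', t', rfl | rfl⟩ := exists_eq_of_mem_Gam hτ <;> rfl

/-- The action of the wreath product on the grid. -/
def gamHom : Gam →* Equiv.Perm Grid :=
  MonoidHom.toHomPerm
    { toFun := fun σ => cellMap σ
      map_one' := rfl
      map_mul' := fun σ τ => cellMap_mul σ.2 τ.2 }

theorem coe_gamHom (σ : Gam) : ⇑(gamHom σ) = cellMap σ := rfl

theorem exists_gamHom_eq (σ : Gam) : ∃ ε s t, gamHom σ = gridPerm ε s t := by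
  obtain ⟨s, t, h | h⟩ := exists_eq_of_mem_Gam σ.2
  · exact ⟨false, s, t, DFunLike.coe_injective (by rw [coe_gamHom, h, cellMap_sumCongr])⟩
  · exact ⟨true, s, t, DFunLike.coe_injective (by rw [coe_gamHom, h, cellMap_sumComm_mul])⟩

theorem gamHom_injective : Function.Injective gamHom := by
  intro σ τ hστ
  have h : cellMap σ = cellMap τ := by rw [← coe_gamHom, hστ, coe_gamHom]
  refine Subtype.ext ?_
  obtain ⟨s, t, h1 | h1⟩ := exists_eq_of_mem_Gam σ.2 <;>
    obtain ⟨s', t', h2 | h2⟩ := exists_eq_of_mem_Gam τ.2 <;>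
    rw [h1, h2] at h ⊢ <;>
    simp only [cellMap_sumCongr, cellMap_sumComm_mul] at h
  · have := gridPerm_injective (a₁ := (false, s, t)) (a₂ := (false, s', t'))
      (DFunLike.coe_injective h)
    simp at this
    rw [this.1, this.2]
  · have := gridPerm_injective (a₁ := (false, s, t)) (a₂ := (true, s', t'))
      (DFunLike.coe_injective h)
    simp at this
  · have := gridPerm_injective (a₁ := (true, s, t)) (a₂ := (false, s', t'))
      (DFunLike.coe_injective h)
    simp at this
  · have := gridPerm_injective (a₁ := (true, s, t)) (a₂ := (true, s', t'))
      (DFunLike.coe_injective h)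
    simp at this
    rw [this.1, this.2]

/-- The automorphism group of the grid is the wreath product. -/
noncomputable def gamEquiv : Gam ≃* gridGroup :=
  MulEquiv.ofBijective ((gamHom.prod gamHom).codRestrict gridGroup fun σ => by
      obtain ⟨ε, s, t, h⟩ := exists_gamHom_eq σ
      rw [MonoidHom.prod_apply, h]
      exact gridPerm_mem ε s t) <| by
    refine ⟨fun σ τ h => gamHom_injective (congrArg (fun g => g.1.1) h), fun g => ?_⟩
    obtain ⟨ε, s, t, h⟩ := exists_eq_gridPerm g.2
    cases ε
    · refine ⟨⟨_, sumCongr_mem_Gam s t⟩, Subtype.ext ?_⟩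
      rw [h]
      rfl
    · refine ⟨⟨_, mul_mem sumComm_mem_Gam (sumCongr_mem_Gam s t)⟩, Subtype.ext ?_⟩
      rw [h]
      rfl

theorem gridGroup_transitive (p q : Grid) : ∃ g ∈ gridGroup, g.2 p = q := by
  refine ⟨_, gridPerm_mem false (Equiv.swap p.1 q.1) (Equiv.swap p.2 q.2), ?_⟩
  simp [gridPerm_false]

end GridGroup

/-! ### Transitivity on planes by counting -/

section Orbits

/-- In a group of order `72` acting on two sets with nine elements, transitively on the second, a
subgroup all of whose orbits on the first set have at least four elements is transitive on the
second. -/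
theorem orbit_eq_univ_of_four_le {A X Y : Type*} [Group A] [MulAction A X] [MulAction A Y]
    (hA : Nat.card A = 72) (hX : Nat.card X = 9) (hY : Nat.card Y = 9)
    [MulAction.IsPretransitive A Y] (H : Subgroup A)
    (h : ∀ x : X, 4 ≤ (MulAction.orbit H x).ncard) (y : Y) : MulAction.orbit H y = Set.univ := by
  have : Finite A := Nat.finite_of_card_ne_zero (by omega)
  have : Finite X := Nat.finite_of_card_ne_zero (by omega)
  have : Finite Y := Nat.finite_of_card_ne_zero (by omega)
  have hH : Nat.card H ∣ 72 := hA ▸ H.card_subgroup_dvd_card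
  have hdvd : ∀ x : X, (MulAction.orbit H x).ncard ∣ Nat.card H := fun x => by
    rw [← MulAction.index_stabilizer]
    exact Subgroup.index_dvd_card _
  have h5 : ∀ x : X, (MulAction.orbit H x).ncard ≠ 5 := fun x hx => by
    have := (hdvd x).trans hH
    rw [hx] at this
    omega
  obtain ⟨x⟩ : Nonempty X := (Nat.card_pos_iff.1 (by omega)).1
  have hdisj : ∀ x x' : X, x' ∉ MulAction.orbit H x →
      Disjoint (MulAction.orbit H x) (MulAction.orbit H x') := fun x x' hx =>
    (MulAction.orbit.eq_or_disjoint x x').resolve_left fun heq =>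
      hx (heq ▸ MulAction.mem_orbit_self x')
  have hle : ∀ s : Set X, s.ncard ≤ 9 := fun s => hX ▸ Set.ncard_le_card s
  -- Two orbits of size at least 4 filling nine points would have sizes 4 and 5, and 5 does not
  -- divide 72; three orbits need at least twelve points.
  have huniv : MulAction.orbit H x = Set.univ := by
    by_contra hne
    obtain ⟨x', hx'⟩ := (Set.ne_univ_iff_exists_notMem _).1 hne
    have d1 := hdisj x x' hx'
    have c1 := Set.ncard_union_eq d1
    have l1 := hle (MulAction.orbit H x ∪ MulAction.orbit H x')
    have := h x
    have := h x'
    have := h5 x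
    have := h5 x'
    obtain ⟨x'', hx''⟩ : ∃ x'', x'' ∉ MulAction.orbit H x ∪ MulAction.orbit H x' := by
      rw [← Set.ne_univ_iff_exists_notMem]
      intro hu
      rw [hu, Set.ncard_univ, hX] at c1
      omega
    simp only [Set.mem_union, not_or] at hx''
    have c2 := Set.ncard_union_eq
      (Set.disjoint_union_left.2 ⟨hdisj x x'' hx''.1, hdisj x' x'' hx''.2⟩)
    have l2 := hle (MulAction.orbit H x ∪ MulAction.orbit H x' ∪ MulAction.orbit H x'')
    have := h x''
    omega
  have h9 : 9 ∣ Nat.card H := by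
    have := hdvd x
    rwa [huniv, Set.ncard_univ, hX] at this
  have hstab : Nat.card (MulAction.stabilizer A y) = 8 := by
    have h1 := (MulAction.stabilizer A y).card_mul_index
    rw [MulAction.index_stabilizer_of_transitive, hA, hY] at h1
    omega
  -- The stabilizer in `H` has order prime to 9, so the factor 9 of the order of `H` must divide the
  -- orbit size.
  have hstabH : Nat.card (MulAction.stabilizer H y) ∣ 8 := by
    rw [← hstab]
    exact Subgroup.card_dvd_of_injective
      ((H.subtype.comp (MulAction.stabilizer H y).subtype).codRestrict (MulAction.stabilizer A y)
        fun g => g.2)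
      fun a b hab => Subtype.ext (Subtype.ext (congrArg (fun g : MulAction.stabilizer A y => (g : A)) hab))
  have horb := (MulAction.stabilizer H y).card_mul_index
  rw [MulAction.index_stabilizer] at horb
  have h9' : 9 ∣ (MulAction.orbit H y).ncard := by
    refine Nat.Coprime.dvd_of_dvd_mul_left (m := Nat.card (MulAction.stabilizer H y)) ?_ ?_
    · exact Nat.Coprime.coprime_dvd_right hstabH (by norm_num)
    · rw [horb]
      exact h9
  have hpos : 0 < (MulAction.orbit H y).ncard :=
    (Set.ncard_pos).2 ⟨y, MulAction.mem_orbit_self y⟩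
  refine Set.eq_univ_of_forall fun z => ?_
  have heq : MulAction.orbit H y = Set.univ := by
    refine Set.eq_of_subset_of_ncard_le (Set.subset_univ _) ?_
    rw [Set.ncard_univ, hY]
    exact Nat.le_of_dvd hpos h9'
  rw [heq]
  trivial

end Orbits

end CubicThreefold

namespace CubicThreefold

open scoped LinearAlgebra.Projectivization
open MvPolynomial

/-! ### Passage from cubic forms to trilinear forms -/

section Polynomial

variable {k : Type*} [Field k]

/-- The trilinear form `M` describes the cubic form `F` and its derivatives. -/
structure IsTrilinearOf (F : MvPolynomial (Fin 5) k)
    (M : (Fin 5 → k) →ₗ[k] (Fin 5 → k) →ₗ[k] (Fin 5 → k) →ₗ[k] k) : Prop where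
  eval_eq : ∀ v, eval v F = cub M v
  eval_pderiv : ∀ v i, eval v (pderiv i F) = dif M v (Pi.single i 1)
  eval_pderiv_pderiv : ∀ v i j,
    eval v (pderiv i (pderiv j F)) = pol M v (Pi.single i 1) (Pi.single j 1)

theorem isTrilinearOf_zero : IsTrilinearOf (0 : MvPolynomial (Fin 5) k) 0 := by
  constructor <;> intros <;> simp [cub, dif, pol]

theorem IsTrilinearOf.add {F G : MvPolynomial (Fin 5) k}
    {M N : (Fin 5 → k) →ₗ[k] (Fin 5 → k) →ₗ[k] (Fin 5 → k) →ₗ[k] k} (hF : IsTrilinearOf F M)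
    (hG : IsTrilinearOf G N) : IsTrilinearOf (F + G) (M + N) := by
  constructor
  · intro v
    rw [map_add, hF.eval_eq, hG.eval_eq]
    simp only [cub, LinearMap.add_apply]
  · intro v i
    rw [map_add, map_add, hF.eval_pderiv, hG.eval_pderiv]
    simp only [dif, LinearMap.add_apply]
    ring
  · intro v i j
    rw [map_add, map_add, map_add, hF.eval_pderiv_pderiv, hG.eval_pderiv_pderiv]
    simp only [pol, LinearMap.add_apply]
    ring

theorem pderiv_X_eq_C (i a : Fin 5) :
    pderiv i (X a : MvPolynomial (Fin 5) k) = C ((Pi.single i 1 : Fin 5 → k) a) := by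
  rw [pderiv_X]
  by_cases h : a = i
  · subst h; simp
  · simp [h]

theorem isTrilinearOf_monomial (c : k) (a b d : Fin 5) :
    IsTrilinearOf (C c * (X a * X b * X d))
      (tri (c • LinearMap.proj a) (LinearMap.proj b) (LinearMap.proj d)) := by
  constructor
  · intro v
    simp [cub, tri_apply]
    ring
  · intro v i
    simp only [dif, tri_apply, LinearMap.smul_apply, LinearMap.proj_apply, pderiv_mul,
      pderiv_X_eq_C, pderiv_C, map_add, map_mul, eval_C, eval_X, smul_eq_mul, map_zero]
    ring
  · intro v i j
    simp only [pol, tri_apply, LinearMap.smul_apply, LinearMap.proj_apply, pderiv_mul,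
      pderiv_X_eq_C, pderiv_C, map_add, map_mul, eval_C, eval_X, smul_eq_mul, map_zero]
    ring

/-- Each cubic monomial is a product of three coordinates and gives a trilinear form `tri`. No
symmetry is demanded, so nothing has to be divided by 6. -/
theorem exists_isTrilinearOf {F : MvPolynomial (Fin 5) k} (hF : F.IsHomogeneous 3) :
    ∃ M, IsTrilinearOf F M := by
  rw [F.as_sum]
  refine Finset.sum_induction _ (fun G => ∃ M, IsTrilinearOf G M)
    (fun G G' ⟨M, hM⟩ ⟨M', hM'⟩ => ⟨M + M', hM.add hM'⟩) ⟨0, isTrilinearOf_zero⟩ fun d hd => ?_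
  have hdeg : d.degree = 3 := by
    rw [Finsupp.degree_eq_weight_one]
    exact hF (mem_support_iff.1 hd)
  have hcard : Multiset.card (Finsupp.toMultiset d) = 3 := by
    rw [Finsupp.card_toMultiset, ← hdeg, Finsupp.degree_eq_sum, Finsupp.sum_fintype]
    · rfl
    · simp
  obtain ⟨a, b, c, h⟩ := Multiset.card_eq_three.1 hcard
  have hd' : d = Finsupp.single a 1 + Finsupp.single b 1 + Finsupp.single c 1 := by
    refine Function.LeftInverse.injective Finsupp.toMultiset_toFinsupp ?_
    rw [h]
    simp [Finsupp.toMultiset_single]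
  refine ⟨_, (?_ : _ = C (coeff d F) * (X a * X b * X c)) ▸
    isTrilinearOf_monomial (coeff d F) a b c⟩
  generalize coeff d F = r
  rw [hd', X, X, X, monomial_mul, monomial_mul, C_mul_monomial]
  simp

theorem IsTrilinearOf.dif_eq_sum {F : MvPolynomial (Fin 5) k}
    {M : (Fin 5 → k) →ₗ[k] (Fin 5 → k) →ₗ[k] (Fin 5 → k) →ₗ[k] k} (h : IsTrilinearOf F M)
    (v w : Fin 5 → k) : dif M v w = ∑ i, w i * eval v (pderiv i F) := by
  conv_lhs => rw [pi_eq_sum_univ' w]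
  simp only [Fin.sum_univ_five, dif_add_right, dif_smul_right, h.eval_pderiv]

theorem IsTrilinearOf.singularPoints_eq {F : MvPolynomial (Fin 5) k}
    {M : (Fin 5 → k) →ₗ[k] (Fin 5 → k) →ₗ[k] (Fin 5 → k) →ₗ[k] k} (h : IsTrilinearOf F M) :
    singularPoints F = singPts M := by
  ext p
  change _ ∧ _ ↔ _ ∧ _
  rw [h.eval_eq]
  refine and_congr_right fun _ => ⟨fun h1 w => ?_, fun h1 i => ?_⟩
  · rw [h.dif_eq_sum]
    simp [h1]
  · rw [h.eval_pderiv, h1]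

theorem IsTrilinearOf.pol_eq_zero_of_mulVec {F : MvPolynomial (Fin 5) k}
    {M : (Fin 5 → k) →ₗ[k] (Fin 5 → k) →ₗ[k] (Fin 5 → k) →ₗ[k] k} (h : IsTrilinearOf F M)
    {v w : Fin 5 → k} (hw : (hessian F v).mulVec w = 0) (u : Fin 5 → k) : pol M v u w = 0 := by
  have h1 : ∀ i, pol M v (Pi.single i 1) w = 0 := fun i => by
    have h2 := congrFun hw i
    simp only [Matrix.mulVec, dotProduct, hessian, Matrix.of_apply, h.eval_pderiv_pderiv,
      Pi.zero_apply] at h2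
    rw [← h2]
    conv_lhs => rw [pi_eq_sum_univ' w]
    simp only [Fin.sum_univ_five, pol_add_right, pol_smul_right]
    ring_nf
  have h3 : u = ∑ i, u i • (Pi.single i 1 : Fin 5 → k) := by
    conv_lhs => rw [pi_eq_sum_univ' u]
  rw [h3]
  simp only [Fin.sum_univ_five, pol_add_mid, pol_smul_mid, h1]
  ring

/-- Frees the singularity condition from the chosen representative, as needed to follow a point
under Galois. -/
theorem mk_mem_singularPoints {F : MvPolynomial (Fin 5) k} (hF : F.IsHomogeneous 3)
    {v : Fin 5 → k} (hv : v ≠ 0) : Projectivization.mk k v hv ∈ singularPoints F ↔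
      eval v F = 0 ∧ ∀ i, eval v (pderiv i F) = 0 := by
  obtain ⟨M, hM⟩ := exists_isTrilinearOf hF
  rw [hM.singularPoints_eq, mk_mem_singPts, IsSing, hM.eval_eq]
  refine and_congr_right fun _ => ⟨fun h i => ?_, fun h w => ?_⟩
  · rw [hM.eval_pderiv, h]
  · rw [hM.dif_eq_sum]
    simp [h]

/-- The geometry of a nine-nodal cubic threefold: the nodes and the planes are indexed by the
cells of a `3 × 3` grid. -/
theorem exists_configuration [Infinite k] {F : MvPolynomial (Fin 5) k} (hF : F.IsHomogeneous 3)
    (h9 : (singularPoints F).ncard = 9) :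
    (∀ p ∈ singularPoints F, IsOrdinaryNode F p) ∧
    ∃ (eN : Grid ≃ singularPoints F) (eP : Grid ≃ planes F),
      (∀ p q, (eN p : P4 k).submodule ≤ (eP q : Submodule k (Fin 5 → k)) ↔ Incident p q) ∧
      ∀ p q, Module.finrank k ((eP p : Submodule k (Fin 5 → k)) ⊓ eP q :
        Submodule k (Fin 5 → k)) = 2 ↔ (p.1 ≠ q.1 ∧ p.2 = q.2) ∨ (p.2 ≠ q.2 ∧ p.1 = q.1) := by
  obtain ⟨M, hM⟩ := exists_isTrilinearOf hF
  have hV : Module.finrank k (Fin 5 → k) = 5 := by simp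
  have hsing := hM.singularPoints_eq
  rw [hsing] at h9
  obtain ⟨N⟩ := exists_normalForm h9 hV
  refine ⟨fun p hp => ⟨hp, fun w hw => ?_⟩, ?_⟩
  · rw [hsing] at hp
    obtain ⟨q, c, hc, hv⟩ := N.exists_smul_node hV h9 p.rep_nonzero hp
    have h1 := hM.pol_eq_zero_of_mulVec hw
    simp only [hv, pol_smul_left, mul_eq_zero, hc, false_or] at h1
    obtain ⟨d, hd⟩ := N.eq_smul_node_of_pol_eq_zero hV q h1
    rw [Projectivization.submodule_eq, Submodule.mem_span_singleton]
    exact ⟨d / c, by rw [hv, hd, smul_smul, div_mul_cancel₀ d hc]⟩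
  · let eN : Grid ≃ singularPoints F :=
      (Equiv.ofBijective _ (N.nodePt_bijective hV h9)).trans (Equiv.setCongr hsing.symm)
    have hplane : ∀ p, N.plane p ∈ planes F := fun p =>
      ⟨N.finrank_plane hV p, fun v hv => by rw [hM.eval_eq, N.cub_of_mem_plane hv]⟩
    let eP : Grid ≃ planes F := Equiv.ofBijective (fun p => ⟨N.plane p, hplane p⟩)
      ⟨fun p q h => N.plane_injective hV (Subtype.ext_iff.1 h), fun W => by
        obtain ⟨p, hp⟩ := N.exists_eq_plane hV (N.α_ne_β hV h9) W.2.1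
          (fun v hv => by rw [← hM.eval_eq, W.2.2 v hv])
        exact ⟨p, Subtype.ext hp.symm⟩⟩
    refine ⟨eN, eP, fun p q => ?_, fun p q => N.finrank_plane_inf hV p q⟩
    rw [Incident, ← N.node_mem_plane hV]
    change k ∙ N.node hV p ≤ N.plane q ↔ _
    rw [Submodule.span_singleton_le_iff_mem]

end Polynomial

/-! ### Transfer of the grid to the configuration of nodes and planes -/

section Configuration

variable {k : Type*} [Field k] {F : MvPolynomial (Fin 5) k}

/-- A labelling of nodes and planes by the grid identifies the symmetry groups. -/
noncomputable def configurationEquiv (eN : Grid ≃ singularPoints F) (eP : Grid ≃ planes F)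
    (h : ∀ p q, (eN p : P4 k).submodule ≤ (eP q : Submodule k (Fin 5 → k)) ↔ Incident p q) :
    gridGroup ≃* configurationGroup F :=
  ((eN.permCongrHom.prodCongr eP.permCongrHom).subgroupMap gridGroup).trans
    (MulEquiv.subgroupCongr (by
      ext g
      refine Subgroup.mem_map_equiv.trans ?_
      change (∀ p q, Incident (eN.symm (g.1 (eN p))) (eP.symm (g.2 (eP q))) ↔ _) ↔ ∀ _ _, _
      simp only [← h, Equiv.apply_symm_apply]
      exact ⟨fun H p W => by simpa using H (eN.symm p) (eP.symm W), fun H p q => H _ _⟩))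

theorem configurationEquiv_snd_apply (eN : Grid ≃ singularPoints F) (eP : Grid ≃ planes F)
    (h : ∀ p q, (eN p : P4 k).submodule ≤ (eP q : Submodule k (Fin 5 → k)) ↔ Incident p q)
    (g : gridGroup) (q : Grid) :
    (configurationEquiv eN eP h g).1.2 (eP q) = eP (g.1.2 q) := by
  change eP (g.1.2 (eP.symm (eP q))) = _
  rw [Equiv.symm_apply_apply]

instance : MulAction (configurationGroup F) (singularPoints F) :=
  MulAction.compHom _ ((MonoidHom.fst _ _).comp (configurationGroup F).subtype)

instance : MulAction (configurationGroup F) (planes F) :=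
  MulAction.compHom _ ((MonoidHom.snd _ _).comp (configurationGroup F).subtype)

theorem configurationGroup_smul_plane (g : configurationGroup F) (W : planes F) :
    g • W = g.1.2 W := rfl

theorem orbit_planes_eq_univ (eN : Grid ≃ singularPoints F) (eP : Grid ≃ planes F)
    (h : ∀ p q, (eN p : P4 k).submodule ≤ (eP q : Submodule k (Fin 5 → k)) ↔ Incident p q)
    (H : Subgroup (configurationGroup F))
    (h4 : ∀ p : singularPoints F, 4 ≤ (MulAction.orbit H p).ncard) (W : planes F) :
    MulAction.orbit H W = Set.univ := by
  have : MulAction.IsPretransitive (configurationGroup F) (planes F) := ⟨fun W W' => by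
    obtain ⟨g, hg, hgW⟩ := gridGroup_transitive (eP.symm W) (eP.symm W')
    refine ⟨configurationEquiv eN eP h ⟨g, hg⟩, ?_⟩
    rw [configurationGroup_smul_plane, ← eP.apply_symm_apply W, configurationEquiv_snd_apply, hgW,
      eP.apply_symm_apply]⟩
  refine orbit_eq_univ_of_four_le ?_ ?_ ?_ H h4 W
  · rw [← Nat.card_congr (configurationEquiv eN eP h).toEquiv, card_gridGroup]
  · rw [← Nat.card_congr eN]
    simp
  · rw [← Nat.card_congr eP]
    simp

/-- A group acting on the configuration such that all orbits of singular points have at least four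
members acts transitively on the planes. -/
theorem exists_plane_eq (eN : Grid ≃ singularPoints F) (eP : Grid ≃ planes F)
    (h : ∀ p q, (eN p : P4 k).submodule ≤ (eP q : Submodule k (Fin 5 → k)) ↔ Incident p q)
    {G : Type*} [Group G] (ρ : G →* configurationGroup F)
    (h4 : ∀ p : singularPoints F, 4 ≤ (Set.range fun g => ((ρ g).1.1 p : P4 k)).ncard)
    (W W' : planes F) : ∃ g, (ρ g).1.2 W = W' := by
  have horb := orbit_planes_eq_univ eN eP h ρ.range (fun p => ?_) W
  · have hmem : W' ∈ MulAction.orbit ρ.range W := by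
      rw [horb]
      trivial
    obtain ⟨⟨_, g, rfl⟩, hg⟩ := hmem
    exact ⟨g, hg⟩
  · have heq : (Set.range fun g => ((ρ g).1.1 p : P4 k)) =
        Subtype.val '' MulAction.orbit ρ.range p := by
      ext q
      constructor
      · rintro ⟨g, rfl⟩
        exact ⟨_, ⟨⟨_, g, rfl⟩, rfl⟩, rfl⟩
      · rintro ⟨_, ⟨⟨_, g, rfl⟩, rfl⟩, rfl⟩
        exact ⟨g, rfl⟩
    have := h4 p
    rwa [heq, Set.ncard_image_of_injective _ Subtype.val_injective] at this

end Configuration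

end CubicThreefold

namespace CubicThreefold

open scoped LinearAlgebra.Projectivization
open MvPolynomial

/-! ### The Galois action on the configuration -/

section Galois

variable {K L : Type*} [Field K] [Field L] [Algebra K L]

theorem galMap_symm_apply (σ : L ≃ₐ[K] L) (v : Fin 5 → L) : galMap σ (galMap σ.symm v) = v :=
  funext fun i => σ.apply_symm_apply (v i)

theorem symm_galMap_apply (σ : L ≃ₐ[K] L) (v : Fin 5 → L) : galMap σ.symm (galMap σ v) = v :=
  funext fun i => σ.symm_apply_apply (v i)

/-- The coefficients come from `K`, so `σ` fixes them and commutes with evaluation. -/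
theorem eval_galMap (σ : L ≃ₐ[K] L) (v : Fin 5 → L) (F : MvPolynomial (Fin 5) K) :
    eval (galMap σ v) (geom L F) = σ (eval v (geom L F)) := by
  rw [geom, eval_map, eval_map, ← aeval_def, ← aeval_def]
  exact DFunLike.congr_fun (comp_aeval v σ.toAlgHom).symm F

theorem eval_galMap_eq_zero_iff (σ : L ≃ₐ[K] L) (v : Fin 5 → L) (F : MvPolynomial (Fin 5) K) :
    eval (galMap σ v) (geom L F) = 0 ↔ eval v (geom L F) = 0 := by
  rw [eval_galMap, map_eq_zero_iff σ σ.injective]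

theorem pderiv_geom (i : Fin 5) (F : MvPolynomial (Fin 5) K) :
    pderiv i (geom L F) = geom L (pderiv i F) := pderiv_map

theorem geom_isHomogeneous {F : MvPolynomial (Fin 5) K} (hF : F.IsHomogeneous 3) :
    (geom L F).IsHomogeneous 3 := hF.map _

theorem galPoint_mem {F : MvPolynomial (Fin 5) K} (hF : F.IsHomogeneous 3) (σ : L ≃ₐ[K] L)
    {p : P4 L} (hp : p ∈ singularPoints (geom L F)) :
    galPoint σ p ∈ singularPoints (geom L F) := by
  induction p using Projectivization.ind with
  | h v hv =>
    rw [galPoint, Projectivization.map_mk, mk_mem_singularPoints (geom_isHomogeneous hF)]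
    rw [mk_mem_singularPoints (geom_isHomogeneous hF)] at hp
    simp only [pderiv_geom, eval_galMap_eq_zero_iff] at hp ⊢
    exact hp

theorem galPoint_one (p : P4 L) : galPoint (1 : L ≃ₐ[K] L) p = p := by
  induction p using Projectivization.ind with
  | h v hv => rfl

theorem galPoint_mul (σ τ : L ≃ₐ[K] L) (p : P4 L) :
    galPoint (σ * τ) p = galPoint σ (galPoint τ p) := by
  induction p using Projectivization.ind with
  | h v hv => rfl

theorem mem_galSubspace {σ : L ≃ₐ[K] L} {W : Submodule L (Fin 5 → L)} {v : Fin 5 → L} :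
    v ∈ galSubspace σ W ↔ galMap σ.symm v ∈ W := by
  rw [galSubspace, Submodule.mem_map]
  constructor
  · rintro ⟨w, hw, rfl⟩
    rwa [symm_galMap_apply]
  · exact fun h => ⟨_, h, galMap_symm_apply σ v⟩

theorem galSubspace_one (W : Submodule L (Fin 5 → L)) : galSubspace (1 : L ≃ₐ[K] L) W = W := by
  ext v
  rw [mem_galSubspace]
  rfl

theorem galSubspace_mul (σ τ : L ≃ₐ[K] L) (W : Submodule L (Fin 5 → L)) :
    galSubspace (σ * τ) W = galSubspace σ (galSubspace τ W) := by
  ext v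
  simp only [mem_galSubspace]
  rfl

/-- The map is only semilinear over `σ`, so dimensions are compared through an additive equivalence
compatible with the field automorphism. -/
theorem finrank_galSubspace (σ : L ≃ₐ[K] L) (W : Submodule L (Fin 5 → L)) :
    Module.finrank L (galSubspace σ W) = Module.finrank L W := by
  let j : W ≃+ galSubspace σ W :=
    { toFun := fun v => ⟨galMap σ v, Submodule.mem_map_of_mem v.2⟩
      invFun := fun v => ⟨galMap σ.symm v, mem_galSubspace.1 v.2⟩
      left_inv := fun v => Subtype.ext (symm_galMap_apply σ v)
      right_inv := fun v => Subtype.ext (galMap_symm_apply σ v)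
      map_add' := fun v w => Subtype.ext (map_add (galMap σ) (v : Fin 5 → L) w) }
  exact (congrArg Cardinal.toNat (rank_eq_of_equiv_equiv σ j σ.bijective
    fun r v => Subtype.ext ((galMap σ).map_smulₛₗ r (v : Fin 5 → L)))).symm

theorem galSubspace_mem {F : MvPolynomial (Fin 5) K} (σ : L ≃ₐ[K] L)
    {W : Submodule L (Fin 5 → L)} (hW : W ∈ planes (geom L F)) :
    galSubspace σ W ∈ planes (geom L F) := by
  refine ⟨by rw [finrank_galSubspace, hW.1], fun v hv => ?_⟩
  rw [← galMap_symm_apply σ v, eval_galMap_eq_zero_iff]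
  exact hW.2 _ (mem_galSubspace.1 hv)

theorem galPoint_submodule_le (σ : L ≃ₐ[K] L) (p : P4 L) (W : Submodule L (Fin 5 → L)) :
    (galPoint σ p).submodule ≤ galSubspace σ W ↔ p.submodule ≤ W := by
  induction p using Projectivization.ind with
  | h v hv =>
    rw [galPoint, Projectivization.map_mk, Projectivization.submodule_mk,
      Projectivization.submodule_mk, Submodule.span_singleton_le_iff_mem,
      Submodule.span_singleton_le_iff_mem, mem_galSubspace, symm_galMap_apply]

/-- The action of the Galois group on the singular points. -/
noncomputable def galPointHom {F : MvPolynomial (Fin 5) K} (hF : F.IsHomogeneous 3) :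
    (L ≃ₐ[K] L) →* Equiv.Perm (singularPoints (geom L F)) :=
  MonoidHom.toHomPerm
    { toFun := fun σ p => ⟨galPoint σ p, galPoint_mem hF σ p.2⟩
      map_one' := funext fun p => Subtype.ext (galPoint_one p.1)
      map_mul' := fun σ τ => funext fun p => Subtype.ext (galPoint_mul σ τ p.1) }

variable (L) in
/-- The action of the Galois group on the planes. -/
noncomputable def galPlaneHom (F : MvPolynomial (Fin 5) K) :
    (L ≃ₐ[K] L) →* Equiv.Perm (planes (geom L F)) :=
  MonoidHom.toHomPerm
    { toFun := fun σ W => ⟨galSubspace σ W, galSubspace_mem σ W.2⟩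
      map_one' := funext fun W => Subtype.ext (galSubspace_one W.1)
      map_mul' := fun σ τ => funext fun W => Subtype.ext (galSubspace_mul σ τ W.1) }

/-- The action of the Galois group on the configuration of singular points and planes. -/
noncomputable def galConfigurationHom {F : MvPolynomial (Fin 5) K} (hF : F.IsHomogeneous 3) :
    (L ≃ₐ[K] L) →* configurationGroup (geom L F) :=
  ((galPointHom hF).prod (galPlaneHom L F)).codRestrict _ fun σ p W =>
    galPoint_submodule_le σ p.1 W.1

end Galois

theorem cycleGraph_three_adj (a b : Fin 3) : (SimpleGraph.cycleGraph 3).Adj a b ↔ a ≠ b := by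
  revert a b
  decide

/-- A labelling of the planes by the grid identifies the graph of planes. -/
noncomputable def planeGraphIso {k : Type*} [Field k] {F : MvPolynomial (Fin 5) k}
    (eP : Grid ≃ planes F)
    (h : ∀ p q, Module.finrank k ((eP p : Submodule k (Fin 5 → k)) ⊓ eP q :
      Submodule k (Fin 5 → k)) = 2 ↔ (p.1 ≠ q.1 ∧ p.2 = q.2) ∨ (p.2 ≠ q.2 ∧ p.1 = q.1)) :
    torusSkeleton ≃g planeGraph F where
  toEquiv := eP
  map_rel_iff' := fun {p q} => by
    refine (h p q).trans ?_
    rw [torusSkeleton, SimpleGraph.boxProd_adj, cycleGraph_three_adj, cycleGraph_three_adj]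

end CubicThreefold

theorem lemma2p1 {K : Type*} {L : Type*} [Field K] [PerfectField K] [Field L] [Algebra K L]
    [IsAlgClosure K L] (F : MvPolynomial (Fin 5) K)
    (hF : CubicThreefold.IsNineNodalCubic L F) :
    -- (i) every singular point is an ordinary node
    (∀ p ∈ CubicThreefold.singularPoints (CubicThreefold.geom L F),
      CubicThreefold.IsOrdinaryNode (CubicThreefold.geom L F) p) ∧
    -- (ii) there are exactly nine planes, and they form a single Galois orbit
    ((CubicThreefold.planes (CubicThreefold.geom L F)).ncard = 9 ∧
      (∀ W ∈ CubicThreefold.planes (CubicThreefold.geom L F),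
        (Set.range fun σ : L ≃ₐ[K] L => CubicThreefold.galSubspace σ W) =
          CubicThreefold.planes (CubicThreefold.geom L F))) ∧
    -- (iii) the graph of planes
    Nonempty (CubicThreefold.planeGraph (CubicThreefold.geom L F) ≃g
      CubicThreefold.torusSkeleton) ∧
    -- (iv) the group of the configuration is the wreath product, and Galois acts through it
    (Nonempty (CubicThreefold.configurationGroup (CubicThreefold.geom L F) ≃*
        CubicThreefold.Gam) ∧
      ∃ ρ : (L ≃ₐ[K] L) →* CubicThreefold.configurationGroup (CubicThreefold.geom L F),
        ∀ σ : L ≃ₐ[K] L,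
          (∀ p, (((ρ σ).1.1 p : _) : CubicThreefold.P4 L) = CubicThreefold.galPoint σ p) ∧
          (∀ W, (((ρ σ).1.2 W : _) : Submodule L (Fin 5 → L)) =
            CubicThreefold.galSubspace σ W)) := by
  open CubicThreefold in
  have hL : IsAlgClosed L := IsAlgClosure.isAlgClosed K
  have hinf : Infinite L := IsAlgClosed.instInfinite
  obtain ⟨hnode, eN, eP, hinc, hadj⟩ :=
    exists_configuration (geom_isHomogeneous hF.cubic) hF.nine
  refine ⟨hnode, ⟨?_, fun W hW => ?_⟩, ⟨(planeGraphIso eP hadj).symm⟩,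
    ⟨(configurationEquiv eN eP hinc).symm.trans gamEquiv.symm⟩,
    galConfigurationHom hF.cubic, fun σ => ⟨fun p => rfl, fun W => rfl⟩⟩
  · rw [← Nat.card_coe_set_eq, ← Nat.card_congr eP]
    simp
  · refine Set.Subset.antisymm ?_ fun W' hW' => ?_
    · rintro _ ⟨σ, rfl⟩
      exact galSubspace_mem σ hW
    · obtain ⟨σ, h⟩ := exists_plane_eq eN eP hinc (galConfigurationHom hF.cubic)
        (fun p => hF.orbits p.1 p.2) ⟨W, hW⟩ ⟨W', hW'⟩
      exact ⟨σ, congrArg Subtype.val h⟩
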